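/- Let $M$ be a complex manifold (of pure finite dimension $n$) with sheaf $\mathcal O$ of holomorphic functions and tangent sheaf $\mathcal T$. Let $\Omega=\bigoplus_{q}\Omega^q=\Lambda_{\mathcal O}(\mathcal T^*)$ be the sheaf of holomorphic differential forms (with $\Omega^q=0$ unless $0\le q\le n$), and let $d$ be the exterior differential. For an integer $p\ge -1$ let $\Omega^p_{\mathcal T}=\mathcal T\otimes_{\mathcal O}\Omega^p$ be the sheaf of holomorphic vector-valued $p$-forms, and let $\mathcal{D}er_p\,\Omega$ be the sheaf whose sections over an open set $U$ are the $\mathbb C$-linear endomorphisms $\delta$ of the sheaf $\Omega|_U$ such that $\delta\Omega^q\subset\Omega^{q+p}$ for all $q$ and $\delta(s\wedge t)=\delta s\wedge t+(-1)^{pq}s\wedge\delta t$ for $s\in\Omega^q$ and $t\in\Omega$. For endomorphisms $a,b$ of degrees $k,l$ put $[a,b]=ab-(-1)^{kl}ba$. For a section $\omega=\sum_j v_j\otimes\eta_j$ of $\Omega^q_{\mathcal T}$ let $i(\omega)$ be the derivation of $\Omega$ of degree $q-1$ given by $i(\omega)s=\sum_j\eta_j\wedge(v_j\lrcorner s)$,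 and for a holomorphic function $\varphi$ put $\omega(\varphi)=\sum_j v_j(\varphi)\,\eta_j\in\Omega^q$. Then a section $\omega$ of $\Omega^p_{\mathcal T}$ is determined by its values $\omega(\varphi)$ on local holomorphic functions $\varphi$, and there is a morphism of sheaves of complex vector spaces $\alpha_p:\mathcal{D}er_p\,\Omega\to\Omega^p_{\mathcal T}$ such that $\delta\varphi=\alpha_p(\delta)(\varphi)$ for all sections $\delta$ of $\mathcal{D}er_p\,\Omega$ and all local holomorphic functions $\varphi$. The sequence of sheaves $$0\to\Omega^{p+1}_{\mathcal T}\xrightarrow{\;\omega\mapsto i(\omega)\;}\mathcal{D}er_p\,\Omega\xrightarrow{\;\alpha_p\;}\Omega^p_{\mathcal T}\to 0$$ is exact, also on sections over every open set, and the morphism $\Omega^p_{\mathcal T}\to\mathcal{D}er_p\,\Omega$, $\omega\mapsto[i(\omega),d]$, of sheaves of complex vector spaces splits it: $\alpha_p([i(\omega),d])=\omega$. Consequently $(\omega,\eta)\mapsto[i(\omega),d]+i(\eta)$ is an isomorphism of sheaves of complex vector spaces $$\Omega^p_{\mathcal T}\oplus\Omega^{p+1}_{\mathcal T}\cong\mathcal{D}er_p\,\Omega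 .$$ Moreover, over every open set $U$, the image of the splitting is the centralizer of $d$ in $\mathcal{D}er_p\,\Omega$, that is, the set of all sections $\delta$ of $\mathcal{D}er_p\,\Omega$ over $U$ with $[\delta,d]=0$. -/

import Mathlib

open scoped Manifold ContDiff TensorProduct ExteriorAlgebra
open TopologicalSpace

namespace HolForm

noncomputable section

/-! ### The exterior algebra of a complex vector space -/

/-- The homogeneous component of degree `q : ℤ` of an exterior algebra (zero if `q < 0`). -/
def piece (W : Type*) [AddCommGroup W] [Module ℂ W] (q : ℤ) :
    Submodule ℂ (ExteriorAlgebra ℂ W) :=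
  if 0 ≤ q then ⋀[ℂ]^(q.toNat) W else ⊥

section Fibre

variable {W W' : Type*} [AddCommGroup W] [Module ℂ W] [AddCommGroup W'] [Module ℂ W']

theorem piece_natCast (k : ℕ) : piece W (k : ℤ) = ⋀[ℂ]^k W := by
  simp [piece]

theorem piece_of_neg {q : ℤ} (h : q < 0) : piece W q = ⊥ := by
  simp [piece, not_le.mpr h]

theorem mul_mem_piece {p q : ℤ} {a b : ExteriorAlgebra ℂ W}
    (ha : a ∈ piece W p) (hb : b ∈ piece W q) : a * b ∈ piece W (p + q) := by
  rcases lt_or_ge p 0 with hp | hp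
  · rw [piece_of_neg hp, Submodule.mem_bot] at ha
    simp [ha]
  rcases lt_or_ge q 0 with hq | hq
  · rw [piece_of_neg hq, Submodule.mem_bot] at hb
    simp [hb]
  lift p to ℕ using hp
  lift q to ℕ using hq
  rw [← Nat.cast_add, piece_natCast] at *
  rw [ExteriorAlgebra.exteriorPower, pow_add]
  exact Submodule.mul_mem_mul ha hb

theorem iota_mem_piece (w : W) : ExteriorAlgebra.ι ℂ w ∈ piece W 1 := by
  have : piece W 1 = ⋀[ℂ]^1 W := piece_natCast 1
  rw [this, ExteriorAlgebra.exteriorPower, pow_one]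
  exact ⟨w, rfl⟩

theorem algebraMap_mem_piece (c : ℂ) : algebraMap ℂ (ExteriorAlgebra ℂ W) c ∈ piece W 0 := by
  have : piece W 0 = ⋀[ℂ]^0 W := piece_natCast 0
  rw [this, ExteriorAlgebra.exteriorPower, pow_zero]
  exact Submodule.mem_one.mpr ⟨c, rfl⟩

theorem map_mem_piece (f : W →ₗ[ℂ] W') {q : ℤ} {a : ExteriorAlgebra ℂ W} (ha : a ∈ piece W q) :
    ExteriorAlgebra.map f a ∈ piece W' q := by
  rcases lt_or_ge q 0 with hq | hq
  · rw [piece_of_neg hq, Submodule.mem_bot] at ha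
    simp [ha]
  lift q to ℕ using hq
  rw [piece_natCast] at *
  have h1 : (⋀[ℂ]^q W).map (ExteriorAlgebra.map f).toLinearMap ≤ ⋀[ℂ]^q W' := by
    rw [ExteriorAlgebra.exteriorPower, Submodule.map_pow, ExteriorAlgebra.ι_range_map_map]
    exact pow_le_pow_left' (LinearMap.map_le_range) q
  exact h1 ⟨a, ha, rfl⟩

theorem involute_iota (w : W) :
    CliffordAlgebra.involute (ExteriorAlgebra.ι ℂ w) = -ExteriorAlgebra.ι ℂ w :=
  CliffordAlgebra.involute_ι w

theorem map_involute (f : W →ₗ[ℂ] W') (a : ExteriorAlgebra ℂ W) :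
    ExteriorAlgebra.map f (CliffordAlgebra.involute a) =
      CliffordAlgebra.involute (ExteriorAlgebra.map f a) := by
  induction a using ExteriorAlgebra.induction with
  | algebraMap r => simp only [AlgHom.commutes]
  | ι v => rw [ExteriorAlgebra.map_apply_ι, involute_iota, involute_iota, map_neg,
      ExteriorAlgebra.map_apply_ι]
  | mul x y hx hy => rw [map_mul, map_mul, map_mul, map_mul, hx, hy]
  | add x y hx hy => rw [map_add, map_add, map_add, map_add, hx, hy]

theorem involute_of_mem_piece {q : ℤ} {a : ExteriorAlgebra ℂ W} (ha : a ∈ piece W q) :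
    CliffordAlgebra.involute a = ((-1 : ℂ) ^ q) • a := by
  rcases lt_or_ge q 0 with hq | hq
  · rw [piece_of_neg hq, Submodule.mem_bot] at ha
    simp [ha]
  lift q to ℕ using hq
  rw [piece_natCast, ExteriorAlgebra.exteriorPower] at ha
  rw [zpow_natCast]
  induction ha using Submodule.pow_induction_on_left' with
  | algebraMap r => simp [Algebra.algebraMap_eq_smul_one]
  | add x y i hx hy ihx ihy => simp [ihx, ihy]
  | mem_mul m hm i x hx ih =>
    obtain ⟨w, rfl⟩ := hm
    rw [map_mul, ih, involute_iota, pow_succ]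
    simp

theorem iota_mul_eq (w : W) (a : ExteriorAlgebra ℂ W) :
    ExteriorAlgebra.ι ℂ w * a = CliffordAlgebra.involute a * ExteriorAlgebra.ι ℂ w := by
  induction a using ExteriorAlgebra.induction with
  | algebraMap r => simp [Algebra.commutes]
  | ι v =>
    rw [involute_iota]
    have := ExteriorAlgebra.ι_add_mul_swap (R := ℂ) w v
    rw [eq_neg_of_add_eq_zero_left this]
    simp
  | mul x y hx hy => rw [← mul_assoc, hx, mul_assoc, hy, map_mul, mul_assoc]
  | add x y hx hy => rw [mul_add, hx, hy, map_add, add_mul]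

/-- Contraction with a vector `v`: the antiderivation of degree `-1` of the exterior algebra
of the dual space with `ξ ↦ ξ v` on covectors. -/
def contract (v : W) :
    ExteriorAlgebra ℂ (Module.Dual ℂ W) →ₗ[ℂ] ExteriorAlgebra ℂ (Module.Dual ℂ W) :=
  CliffordAlgebra.contractLeft (Q := 0) (Module.Dual.eval ℂ W v)

theorem contract_algebraMap (v : W) (c : ℂ) : contract v (algebraMap ℂ _ c) = 0 :=
  CliffordAlgebra.contractLeft_algebraMap (0 : QuadraticForm ℂ (Module.Dual ℂ W)) (Module.Dual.eval ℂ W v) c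

theorem contract_iota (v : W) (ξ : Module.Dual ℂ W) :
    contract v (ExteriorAlgebra.ι ℂ ξ) = algebraMap ℂ _ (ξ v) :=
  CliffordAlgebra.contractLeft_ι (0 : QuadraticForm ℂ (Module.Dual ℂ W)) (Module.Dual.eval ℂ W v) ξ

theorem contract_iota_mul (v : W) (ξ : Module.Dual ℂ W) (b) :
    contract v (ExteriorAlgebra.ι ℂ ξ * b) = ξ v • b - ExteriorAlgebra.ι ℂ ξ * contract v b :=
  CliffordAlgebra.contractLeft_ι_mul (Q := (0 : QuadraticForm ℂ (Module.Dual ℂ W))) (Module.Dual.eval ℂ W v) ξ b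

theorem contract_mul (v : W) (a b : ExteriorAlgebra ℂ (Module.Dual ℂ W)) :
    contract v (a * b) = contract v a * b + CliffordAlgebra.involute a * contract v b := by
  induction a using CliffordAlgebra.left_induction generalizing b with
  | algebraMap r =>
    erw [contract_algebraMap, ← Algebra.smul_def, map_smul, AlgHom.commutes]
    rw [zero_mul, zero_add, Algebra.smul_def]
  | add x y hx hy =>
    have := hx b
    have := hy b
    erw [add_mul, map_add, hx b, hy b, map_add, map_add]
    rw [add_mul, add_mul]
    abel
  | ι_mul x m hx =>
    have h1 := contract_iota_mul v m (x * b)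
    have h2 := contract_iota_mul v m x
    have h3 := hx b
    have h4 : CliffordAlgebra.involute (CliffordAlgebra.ι 0 m * x)
      = - (CliffordAlgebra.ι 0 m * CliffordAlgebra.involute x) := by
      rw [map_mul, CliffordAlgebra.involute_ι, neg_mul]
    rw [← mul_assoc] at h1
    erw [h1, h2, h3, h4]
    erw [sub_mul, mul_add, smul_mul_assoc, neg_mul, mul_assoc, mul_assoc]
    abel

theorem contract_mem_piece (v : W) {q : ℤ} {a : ExteriorAlgebra ℂ (Module.Dual ℂ W)}
    (ha : a ∈ piece _ q) : contract v a ∈ piece _ (q - 1) := by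
  rcases lt_or_ge q 0 with hq | hq
  · rw [piece_of_neg hq, Submodule.mem_bot] at ha
    simp [ha]
  lift q to ℕ using hq
  rw [piece_natCast, ExteriorAlgebra.exteriorPower] at ha
  induction ha using Submodule.pow_induction_on_left' with
  | algebraMap r => rw [contract_algebraMap]; exact zero_mem _
  | add x y i hx hy ihx ihy => rw [map_add]; exact add_mem ihx ihy
  | mem_mul m hm i x hx ih =>
    obtain ⟨w, rfl⟩ := hm
    rw [contract_iota_mul]
    have e : ((i.succ : ℕ) : ℤ) - 1 = i := by push_cast; ring
    rw [e]
    refine sub_mem (Submodule.smul_mem _ _ ?_) ?_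
    · rw [piece_natCast]; exact hx
    · have := mul_mem_piece (iota_mem_piece w) ih
      rwa [show (1 : ℤ) + ((i : ℤ) - 1) = i by ring] at this

theorem mul_comm_piece {p q : ℤ} {a b : ExteriorAlgebra ℂ W}
    (ha : a ∈ piece W p) (hb : b ∈ piece W q) : a * b = ((-1 : ℂ) ^ (p * q)) • (b * a) := by
  rcases lt_or_ge p 0 with hp | hp
  · rw [piece_of_neg hp, Submodule.mem_bot] at ha
    simp [ha]
  lift p to ℕ using hp
  rw [piece_natCast, ExteriorAlgebra.exteriorPower] at ha
  induction ha using Submodule.pow_induction_on_left' with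
  | algebraMap r => simp [Algebra.commutes]
  | add x y i hx hy ihx ihy => rw [add_mul, ihx, ihy, mul_add, smul_add]
  | mem_mul m hm i x hx ih =>
    obtain ⟨w, rfl⟩ := hm
    rw [mul_assoc, ih, mul_smul_comm, ← mul_assoc, iota_mul_eq, involute_of_mem_piece hb,
      smul_mul_assoc, smul_mul_assoc, smul_smul, mul_assoc]
    congr 1
    rw [← zpow_add₀ (by norm_num)]
    congr 1
    push_cast
    ring

/-- The operator on exterior forms defined by a vector-valued form: `v ⊗ η` sends a form `s`
to `η ∧ (v ⌟ s)`. -/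
def insertFibre : W ⊗[ℂ] ExteriorAlgebra ℂ (Module.Dual ℂ W) →ₗ[ℂ]
    Module.End ℂ (ExteriorAlgebra ℂ (Module.Dual ℂ W)) :=
  TensorProduct.lift <| LinearMap.mk₂ ℂ (fun v η ↦ LinearMap.mulLeft ℂ η ∘ₗ contract v)
    (by intro v w η; refine LinearMap.ext fun s ↦ ?_; simp [contract, mul_add])
    (by intro c v η; refine LinearMap.ext fun s ↦ ?_; simp [contract])
    (by intro v η θ; refine LinearMap.ext fun s ↦ ?_; simp [add_mul])
    (by intro c v η; refine LinearMap.ext fun s ↦ ?_; simp)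

@[simp] theorem insertFibre_tmul (v : W) (η s : ExteriorAlgebra ℂ (Module.Dual ℂ W)) :
    insertFibre (v ⊗ₜ[ℂ] η) s = η * contract v s := rfl

/-- The value of a vector-valued form on a covector `ξ`: `v ⊗ η ↦ ξ(v) η`. -/
def pairFibre (ξ : Module.Dual ℂ W) : W ⊗[ℂ] ExteriorAlgebra ℂ (Module.Dual ℂ W) →ₗ[ℂ]
    ExteriorAlgebra ℂ (Module.Dual ℂ W) :=
  (TensorProduct.lid ℂ _).toLinearMap ∘ₗ ξ.rTensor _

theorem pairFibre_tmul (ξ : Module.Dual ℂ W) (v : W) (η : ExteriorAlgebra ℂ (Module.Dual ℂ W)) :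
    pairFibre ξ (v ⊗ₜ[ℂ] η) = ξ v • η := by simp [pairFibre]

/-- The vector-valued forms of degree `q`. -/
def vecPiece (W : Type*) [AddCommGroup W] [Module ℂ W] (q : ℤ) :
    Submodule ℂ (W ⊗[ℂ] ExteriorAlgebra ℂ (Module.Dual ℂ W)) :=
  Submodule.span ℂ {τ | ∃ v : W, ∃ η ∈ piece (Module.Dual ℂ W) q, τ = v ⊗ₜ η}

theorem insertFibre_mem {p q : ℤ} {τ : W ⊗[ℂ] ExteriorAlgebra ℂ (Module.Dual ℂ W)}
    (hτ : τ ∈ vecPiece W p) {s : ExteriorAlgebra ℂ (Module.Dual ℂ W)} (hs : s ∈ piece _ q) :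
    insertFibre τ s ∈ piece _ (q + (p - 1)) := by
  induction hτ using Submodule.span_induction with
  | mem x hx =>
    obtain ⟨v, η, hη, rfl⟩ := hx
    have := mul_mem_piece hη (contract_mem_piece v hs)
    rw [insertFibre_tmul]
    convert this using 2
    ring
  | zero => simp
  | add x y _ _ hx hy => simpa using add_mem hx hy
  | smul c x _ hx => simpa using Submodule.smul_mem _ c hx

theorem insertFibre_mul {p q : ℤ} {τ : W ⊗[ℂ] ExteriorAlgebra ℂ (Module.Dual ℂ W)}
    (hτ : τ ∈ vecPiece W p) {s : ExteriorAlgebra ℂ (Module.Dual ℂ W)} (hs : s ∈ piece _ q)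
    (t : ExteriorAlgebra ℂ (Module.Dual ℂ W)) :
    insertFibre τ (s * t) =
      insertFibre τ s * t + ((-1 : ℂ) ^ ((p - 1) * q)) • (s * insertFibre τ t) := by
  induction hτ using Submodule.span_induction with
  | mem x hx =>
    obtain ⟨v, η, hη, rfl⟩ := hx
    simp only [insertFibre_tmul]
    rw [contract_mul, involute_of_mem_piece hs, mul_add, mul_assoc, smul_mul_assoc,
      mul_smul_comm, ← mul_assoc η s, mul_comm_piece hη hs, smul_mul_assoc, smul_smul,
      mul_assoc s]
    congr 2
    have : (p - 1) * q = q + p * q - 2 * q := by ring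
    rw [this, zpow_sub₀ (by norm_num), zpow_add₀ (by norm_num), zpow_mul (-1 : ℂ) 2 q]
    norm_num
  | zero => simp
  | add x y _ _ hx hy =>
    simp only [map_add, LinearMap.add_apply, hx, hy, add_mul, mul_add, smul_add]
    abel
  | smul c x _ hx =>
    simp only [map_smul, LinearMap.smul_apply, hx, smul_add, smul_mul_assoc, mul_smul_comm]
    rw [smul_comm]

end Fibre

/-! ### The exterior derivative of forms on a vector space -/

section Flat

variable {E : Type*} [NormedAddCommGroup E] [NormedSpace ℂ E] [FiniteDimensional ℂ E]

/-- The index set of a basis of the exterior algebra of the dual of `E`. -/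
abbrev BIdx (E : Type*) [NormedAddCommGroup E] [NormedSpace ℂ E] : Type :=
  Finset (Fin (Module.finrank ℂ (Module.Dual ℂ E)))

/-- A basis of the exterior algebra of the dual of a finite-dimensional space (the products
`e_{i_1} ∧ ⋯ ∧ e_{i_k}`, `i_1 < ⋯ < i_k`, for a basis `e` of the dual). -/
def extBasis (E : Type*) [NormedAddCommGroup E] [NormedSpace ℂ E] [FiniteDimensional ℂ E] :
    Module.Basis (BIdx E) ℂ
      (ExteriorAlgebra ℂ (Module.Dual ℂ E)) :=
  (Module.finBasis ℂ (Module.Dual ℂ E)).ExteriorAlgebra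

/-- The derivative of a function on `E`, as a covector. -/
def grad (g : E → ℂ) (z : E) : Module.Dual ℂ E := (fderiv ℂ g z).toLinearMap

/-- The exterior derivative `d (∑ s_J e_J) = ∑ d s_J ∧ e_J` of a form on a vector space. -/
def flatD (s : E → ExteriorAlgebra ℂ (Module.Dual ℂ E)) (z : E) :
    ExteriorAlgebra ℂ (Module.Dual ℂ E) :=
  ∑ J, ExteriorAlgebra.ι ℂ (grad (fun w ↦ (extBasis E).coord J (s w)) z) * extBasis E J

/-- All coefficients of the form `s` are differentiable at `z`. -/
def CoefDiff (s : E → ExteriorAlgebra ℂ (Module.Dual ℂ E)) (z : E) : Prop :=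
  ∀ J, DifferentiableAt ℂ (fun w ↦ (extBasis E).coord J (s w)) z

open Filter Topology

theorem flatD_congr {s t : E → ExteriorAlgebra ℂ (Module.Dual ℂ E)} {z : E} (h : s =ᶠ[𝓝 z] t) :
    flatD s z = flatD t z := by
  unfold flatD grad
  refine Finset.sum_congr rfl fun J _ ↦ ?_
  have : (fun w ↦ (extBasis E).coord J (s w)) =ᶠ[𝓝 z] fun w ↦ (extBasis E).coord J (t w) :=
    h.mono fun w hw ↦ by simp only [hw]
  rw [this.fderiv_eq]

theorem CoefDiff.congr {s t : E → ExteriorAlgebra ℂ (Module.Dual ℂ E)} {z : E}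
    (hs : CoefDiff s z) (h : t =ᶠ[𝓝 z] s) : CoefDiff t z := fun J ↦
  (hs J).congr_of_eventuallyEq (h.mono fun w hw ↦ by simp only [hw])

theorem coefDiff_of_sum {ι : Type*} [Fintype ι] {s : E → ExteriorAlgebra ℂ (Module.Dual ℂ E)}
    {z : E} (g : ι → E → ℂ) (a : ι → ExteriorAlgebra ℂ (Module.Dual ℂ E))
    (hg : ∀ j, DifferentiableAt ℂ (g j) z) (h : s =ᶠ[𝓝 z] fun w ↦ ∑ j, g j w • a j) :
    CoefDiff s z := by
  refine CoefDiff.congr (s := fun w ↦ ∑ j, g j w • a j) (fun J ↦ ?_) h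
  simp only [map_sum, map_smul, smul_eq_mul]
  exact DifferentiableAt.fun_sum fun j _ ↦ (hg j).mul_const _

theorem flatD_of_sum {ι : Type*} [Fintype ι] {s : E → ExteriorAlgebra ℂ (Module.Dual ℂ E)}
    {z : E} (g : ι → E → ℂ) (a : ι → ExteriorAlgebra ℂ (Module.Dual ℂ E))
    (hg : ∀ j, DifferentiableAt ℂ (g j) z) (h : s =ᶠ[𝓝 z] fun w ↦ ∑ j, g j w • a j) :
    flatD s z = ∑ j, ExteriorAlgebra.ι ℂ (grad (g j) z) * a j := by
  rw [flatD_congr h]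
  unfold flatD
  have key : ∀ J, grad (fun w ↦ (extBasis E).coord J (∑ j, g j w • a j)) z
      = ∑ j, ((extBasis E).coord J (a j)) • grad (g j) z := by
    intro J
    ext v
    simp only [map_sum, map_smul, smul_eq_mul, grad]
    rw [fderiv_fun_sum fun j _ ↦ (hg j).mul_const _]
    simp only [ContinuousLinearMap.coe_coe, LinearMap.sum_apply, LinearMap.smul_apply,
      smul_eq_mul, sum_apply]
    refine Finset.sum_congr rfl fun j _ ↦ ?_
    rw [fderiv_mul_const (hg j)]
    simp
  simp_rw [key]
  simp only [map_sum, map_smul, Finset.sum_mul, smul_mul_assoc]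
  rw [Finset.sum_comm]
  refine Finset.sum_congr rfl fun j _ ↦ ?_
  have : a j = ∑ J, ((extBasis E).coord J (a j)) • extBasis E J := ((extBasis E).sum_repr _).symm
  conv_rhs => rw [this]
  rw [Finset.mul_sum]
  simp only [mul_smul_comm]

theorem sum_coord (s : E → ExteriorAlgebra ℂ (Module.Dual ℂ E)) :
    s = fun w ↦ ∑ J, (extBasis E).coord J (s w) • extBasis E J :=
  funext fun w ↦ ((extBasis E).sum_repr (s w)).symm

theorem grad_mul {f g : E → ℂ} {z : E} (hf : DifferentiableAt ℂ f z)
    (hg : DifferentiableAt ℂ g z) :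
    grad (fun w ↦ f w * g w) z = f z • grad g z + g z • grad f z := by
  unfold grad
  rw [fderiv_fun_mul hf hg]
  rfl

section
variable {s t : E → ExteriorAlgebra ℂ (Module.Dual ℂ E)} {z : E}

theorem coefDiff_add (hs : CoefDiff s z) (ht : CoefDiff t z) :
    CoefDiff (fun w ↦ s w + t w) z := fun J ↦ by
  simp only [map_add]
  exact (hs J).add (ht J)

theorem flatD_add (hs : CoefDiff s z) (ht : CoefDiff t z) :
    flatD (fun w ↦ s w + t w) z = flatD s z + flatD t z := by
  unfold flatD
  rw [← Finset.sum_add_distrib]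
  refine Finset.sum_congr rfl fun J _ ↦ ?_
  rw [← add_mul, ← map_add]
  congr 2
  unfold grad
  simp only [map_add]
  rw [fderiv_fun_add (hs J) (ht J)]
  rfl

theorem flatD_smul (c : ℂ) : flatD (fun w ↦ c • s w) z = c • flatD s z := by
  unfold flatD
  rw [Finset.smul_sum]
  refine Finset.sum_congr rfl fun J _ ↦ ?_
  rw [← smul_mul_assoc, ← map_smul]
  congr 2
  unfold grad
  simp only [map_smul]
  rw [← Pi.smul_def, fderiv_const_smul_field]
  rfl

theorem mul_eq_sum : (fun w ↦ s w * t w) = fun w ↦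
    ∑ P : BIdx E × BIdx E,
      ((extBasis E).coord P.1 (s w) * (extBasis E).coord P.2 (t w)) •
        (extBasis E P.1 * extBasis E P.2) := by
  funext w
  conv_lhs => rw [sum_coord s, sum_coord t]
  simp only [Finset.sum_mul_sum, Fintype.sum_prod_type, smul_mul_smul_comm]

theorem coefDiff_mul (hs : CoefDiff s z) (ht : CoefDiff t z) :
    CoefDiff (fun w ↦ s w * t w) z :=
  coefDiff_of_sum (fun P : BIdx E × BIdx E ↦ fun w ↦ (extBasis E).coord P.1 (s w) * (extBasis E).coord P.2 (t w))
    (fun P ↦ extBasis E P.1 * extBasis E P.2)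
    (fun P ↦ (hs P.1).mul (ht P.2)) (Eq.eventuallyEq mul_eq_sum)

theorem flatD_mul (hs : CoefDiff s z) (ht : CoefDiff t z) :
    flatD (fun w ↦ s w * t w) z =
      flatD s z * t z + CliffordAlgebra.involute (s z) * flatD t z := by
  rw [flatD_of_sum (fun P : BIdx E × BIdx E ↦ fun w ↦ (extBasis E).coord P.1 (s w) * (extBasis E).coord P.2 (t w))
    (fun P ↦ extBasis E P.1 * extBasis E P.2)
    (fun P ↦ (hs P.1).mul (ht P.2)) (Eq.eventuallyEq mul_eq_sum)]
  have e1 : flatD s z * t z = ∑ P : BIdx E × BIdx E, (extBasis E).coord P.2 (t z) •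
      (ExteriorAlgebra.ι ℂ (grad (fun w ↦ (extBasis E).coord P.1 (s w)) z) *
        (extBasis E P.1 * extBasis E P.2)) := by
    conv_lhs => rw [sum_coord t]
    unfold flatD
    simp only [Finset.sum_mul_sum, Fintype.sum_prod_type, mul_smul_comm, mul_assoc]
  have e2 : CliffordAlgebra.involute (s z) * flatD t z =
      ∑ P : BIdx E × BIdx E, (extBasis E).coord P.1 (s z) •
      (ExteriorAlgebra.ι ℂ (grad (fun w ↦ (extBasis E).coord P.2 (t w)) z) *
        (extBasis E P.1 * extBasis E P.2)) := by
    conv_lhs => rw [sum_coord s]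
    unfold flatD
    simp only [map_sum, map_smul, Finset.sum_mul_sum, Fintype.sum_prod_type, smul_mul_assoc]
    refine Finset.sum_congr rfl fun J _ ↦ Finset.sum_congr rfl fun K _ ↦ ?_
    rw [← mul_assoc, ← mul_assoc, iota_mul_eq]
  rw [e1, e2, ← Finset.sum_add_distrib]
  refine Finset.sum_congr rfl fun P _ ↦ ?_
  rw [grad_mul (hs P.1) (ht P.2), map_add, map_smul, map_smul, add_mul, smul_mul_assoc,
    smul_mul_assoc, add_comm]

theorem coefDiff_algebraMap {f : E → ℂ} (hf : DifferentiableAt ℂ f z) :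
    CoefDiff (fun w ↦ algebraMap ℂ (ExteriorAlgebra ℂ (Module.Dual ℂ E)) (f w)) z :=
  coefDiff_of_sum (ι := Unit) (fun _ ↦ f) (fun _ ↦ 1) (fun _ ↦ hf)
    (Eq.eventuallyEq (funext fun w ↦ by simp [Algebra.algebraMap_eq_smul_one]))

theorem flatD_algebraMap {f : E → ℂ} (hf : DifferentiableAt ℂ f z) :
    flatD (fun w ↦ algebraMap ℂ (ExteriorAlgebra ℂ (Module.Dual ℂ E)) (f w)) z =
      ExteriorAlgebra.ι ℂ (grad f z) := by
  rw [flatD_of_sum (ι := Unit) (fun _ ↦ f) (fun _ ↦ 1) (fun _ ↦ hf)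
    (Eq.eventuallyEq (funext fun w ↦ by simp [Algebra.algebraMap_eq_smul_one]))]
  simp

theorem iota_grad_eq_sum (g : E → ℂ) :
    (fun w ↦ ExteriorAlgebra.ι ℂ (grad g w)) = fun w ↦
      ∑ i, (fderiv ℂ g w (Module.finBasis ℂ E i)) •
        ExteriorAlgebra.ι ℂ ((Module.finBasis ℂ E).coord i) := by
  funext w
  simp only [← map_smul, ← map_sum]
  congr 1
  refine (Module.finBasis ℂ E).ext fun j ↦ ?_
  simp [grad, Finsupp.single_apply]

theorem coefDiff_iota_grad {g : E → ℂ} (hg : ContDiffAt ℂ 2 g z) :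
    CoefDiff (fun w ↦ ExteriorAlgebra.ι ℂ (grad g w)) z := by
  have h1 : DifferentiableAt ℂ (fderiv ℂ g) z :=
    (hg.fderiv_right (m := 1) (by norm_num)).differentiableAt (by norm_num)
  exact coefDiff_of_sum _ _ (fun i ↦ h1.clm_apply (differentiableAt_const _))
    (Eq.eventuallyEq (iota_grad_eq_sum g))

theorem flatD_iota_grad {g : E → ℂ} (hg : ContDiffAt ℂ 2 g z) :
    flatD (fun w ↦ ExteriorAlgebra.ι ℂ (grad g w)) z = 0 := by
  have h1 : DifferentiableAt ℂ (fderiv ℂ g) z :=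
    (hg.fderiv_right (m := 1) (by norm_num)).differentiableAt (by norm_num)
  rw [flatD_of_sum _ _ (fun i ↦ h1.clm_apply (differentiableAt_const _))
    (Eq.eventuallyEq (iota_grad_eq_sum g))]
  set b := Module.finBasis ℂ E
  have h2 : ∀ i, grad (fun w ↦ fderiv ℂ g w (b i)) z =
      ∑ j, (fderiv ℂ (fderiv ℂ g) z (b j) (b i)) • b.coord j := by
    intro i
    refine b.ext fun j ↦ ?_
    unfold grad
    rw [fderiv_clm_apply h1 (differentiableAt_const _)]
    simp [Finsupp.single_apply]
  have h3 : IsSymmSndFDerivAt ℂ g z := hg.isSymmSndFDerivAt (by simp)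
  simp only [h2, map_sum, map_smul, Finset.sum_mul, smul_mul_assoc]
  set S := ∑ i, ∑ j, (fderiv ℂ (fderiv ℂ g) z (b j) (b i)) •
    (ExteriorAlgebra.ι ℂ (b.coord j) * ExteriorAlgebra.ι ℂ (b.coord i)) with hS
  have h4 : S = -S := by
    conv_lhs => rw [hS, Finset.sum_comm]
    rw [hS, ← Finset.sum_neg_distrib]
    refine Finset.sum_congr rfl fun i _ ↦ ?_
    rw [← Finset.sum_neg_distrib]
    refine Finset.sum_congr rfl fun j _ ↦ ?_
    rw [h3.eq, ← smul_neg]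
    congr 1
    exact eq_neg_of_add_eq_zero_left (ExteriorAlgebra.ι_add_mul_swap _ _)
  have h5 : (2 : ℂ) • S = 0 := by rw [two_smul]; nth_rw 2 [h4]; exact add_neg_cancel S
  exact (smul_eq_zero.mp h5).resolve_left two_ne_zero

theorem flatD_mem_piece {q : ℤ} (hs : CoefDiff s z) (h : ∀ᶠ w in 𝓝 z, s w ∈ piece _ q) :
    flatD s z ∈ piece (Module.Dual ℂ E) (1 + q) := by
  obtain ⟨n, ⟨b⟩⟩ : ∃ n, Nonempty (Module.Basis (Fin n) ℂ (piece (Module.Dual ℂ E) q)) := by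
    have : Module.Finite ℂ (ExteriorAlgebra ℂ (Module.Dual ℂ E)) :=
      Module.Finite.of_basis (extBasis E)
    exact ⟨_, ⟨Module.finBasis ℂ _⟩⟩
  have hext : ∀ j, ∃ ℓ : ExteriorAlgebra ℂ (Module.Dual ℂ E) →ₗ[ℂ] ℂ,
      ℓ ∘ₗ (piece (Module.Dual ℂ E) q).subtype = b.coord j := fun j ↦
    LinearMap.exists_extend (b.coord j)
  choose ℓ hℓ using hext
  have hdiff : ∀ j, DifferentiableAt ℂ (fun w ↦ ℓ j (s w)) z := by
    intro j
    have : (fun w ↦ ℓ j (s w)) =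
        fun w ↦ ∑ J, (extBasis E).coord J (s w) * ℓ j (extBasis E J) := by
      funext w
      conv_lhs => rw [sum_coord s]
      simp only [map_sum, map_smul, smul_eq_mul]
    rw [this]
    exact DifferentiableAt.fun_sum fun J _ ↦ (hs J).mul_const _
  rw [flatD_of_sum (fun j w ↦ ℓ j (s w)) (fun j ↦ (b j : ExteriorAlgebra ℂ (Module.Dual ℂ E)))
    hdiff ?_]
  · exact sum_mem fun j _ ↦ mul_mem_piece (iota_mem_piece _) (b j).2
  · filter_upwards [h] with w hw
    have h1 := congrArg Subtype.val (b.sum_repr ⟨s w, hw⟩)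
    simp only [Submodule.coe_sum, Submodule.coe_smul] at h1
    rw [← h1]
    refine Finset.sum_congr rfl fun j _ ↦ ?_
    congr 1
    rw [h1]
    exact (LinearMap.congr_fun (hℓ j) ⟨s w, hw⟩).symm

end
end Flat

/-! ### Holomorphic forms on a complex manifold -/

section Manifold

variable (E : Type*) [NormedAddCommGroup E] [NormedSpace ℂ E]
  {M : Type*} [TopologicalSpace M] [ChartedSpace E M]

/-- The cotangent space of `M` at `x`. -/
abbrev Cot (x : M) : Type _ := Module.Dual ℂ (TangentSpace 𝓘(ℂ, E) x)

/-- Arbitrary (not necessarily continuous) sections over `U` of the exterior algebra of the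
cotangent bundle. -/
abbrev RawForm (U : Opens M) : Type _ := ∀ x : U, ExteriorAlgebra ℂ (Cot E x.1)

/-- Restriction of sections. -/
def RawForm.res {U V : Opens M} (h : V ≤ U) : RawForm E U →ₐ[ℂ] RawForm E V :=
  AlgHom.pi fun x ↦ Pi.evalAlgHom ℂ (fun x : U ↦ ExteriorAlgebra ℂ (Cot E x.1)) ⟨x.1, h x.2⟩

/-- `f` is holomorphic on the open set `V`. -/
def IsHol (f : M → ℂ) (V : Opens M) : Prop := ContMDiffOn 𝓘(ℂ, E) 𝓘(ℂ, ℂ) ω f V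

/-- The differential of a function at a point. -/
def differential (f : M → ℂ) (x : M) : Cot E x :=
  (mfderiv 𝓘(ℂ, E) 𝓘(ℂ, ℂ) f x).toLinearMap

/-- A function as a form of degree `0`. -/
def funField (f : M → ℂ) (V : Opens M) : RawForm E V := fun x ↦ algebraMap ℂ _ (f x.1)

/-- The form `df`. -/
def diffField (f : M → ℂ) (V : Opens M) : RawForm E V :=
  fun x ↦ ExteriorAlgebra.ι ℂ (differential E f x.1)

/-- The algebra of sections over `V` generated by the functions `f` and the `1`-forms `df` for `f`
holomorphic on `V`. -/
def regular (V : Opens M) : Subalgebra ℂ (RawForm E V) :=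
  Algebra.adjoin ℂ {a | ∃ f : M → ℂ, IsHol E f V ∧ (a = funField E f V ∨ a = diffField E f V)}

variable {E}

@[simp] theorem RawForm.res_apply {U V : Opens M} (h : V ≤ U) (s : RawForm E U) (x : V) :
    RawForm.res E h s x = s ⟨x.1, h x.2⟩ := rfl

theorem regular_res {U V : Opens M} (h : V ≤ U) {a : RawForm E U} (ha : a ∈ regular E U) :
    RawForm.res E h a ∈ regular E V := by
  have : regular E U ≤ (regular E V).comap (RawForm.res E h) := by
    refine Algebra.adjoin_le ?_
    rintro _ ⟨f, hf, rfl | rfl⟩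
    · exact Algebra.subset_adjoin ⟨f, hf.mono h, Or.inl rfl⟩
    · exact Algebra.subset_adjoin ⟨f, hf.mono h, Or.inr rfl⟩
  exact this ha

variable (E) in
/-- The algebra `Ω(U)` of holomorphic forms over `U`, as a subalgebra: the sections which are locally polynomials
(with respect to the exterior product) in holomorphic functions `f` and their differentials
`df`. -/
def formsAlg (U : Opens M) : Subalgebra ℂ (RawForm E U) where
  carrier := {s | ∀ x ∈ U, ∃ (V : Opens M) (h : V ≤ U), x ∈ V ∧ RawForm.res E h s ∈ regular E V}
  mul_mem' := by
    intro a b ha hb x hx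
    obtain ⟨V, hV, hxV, haV⟩ := ha x hx
    obtain ⟨W, hW, hxW, hbW⟩ := hb x hx
    refine ⟨V ⊓ W, inf_le_left.trans hV, ⟨hxV, hxW⟩, ?_⟩
    rw [map_mul]
    exact mul_mem (regular_res inf_le_left haV) (regular_res inf_le_right hbW)
  add_mem' := by
    intro a b ha hb x hx
    obtain ⟨V, hV, hxV, haV⟩ := ha x hx
    obtain ⟨W, hW, hxW, hbW⟩ := hb x hx
    refine ⟨V ⊓ W, inf_le_left.trans hV, ⟨hxV, hxW⟩, ?_⟩
    rw [map_add]
    exact add_mem (regular_res inf_le_left haV) (regular_res inf_le_right hbW)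
  algebraMap_mem' := by
    intro r x hx
    exact ⟨U, le_rfl, hx, by rw [AlgHom.commutes]; exact Subalgebra.algebraMap_mem _ r⟩

variable (E) in
/-- The algebra `Ω(U)` of holomorphic forms over `U`. -/
def Forms (U : Opens M) : Type _ := formsAlg E U

instance (U : Opens M) : Ring (Forms E U) := inferInstanceAs (Ring (formsAlg E U))
instance (U : Opens M) : Algebra ℂ (Forms E U) := inferInstanceAs (Algebra ℂ (formsAlg E U))

variable (E) in
/-- The inclusion of the holomorphic forms in all sections. -/
def Forms.val (U : Opens M) : Forms E U →ₐ[ℂ] RawForm E U := (formsAlg E U).val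

theorem Forms.ext {U : Opens M} {s t : Forms E U} (h : s.1 = t.1) : s = t := Subtype.ext h

theorem mem_Forms_of_regular {U : Opens M} {s : RawForm E U} (hs : s ∈ regular E U) :
    s ∈ formsAlg E U := fun _ hx ↦ ⟨U, le_rfl, hx, hs⟩

theorem Forms_res {U V : Opens M} (h : V ≤ U) {s : RawForm E U} (hs : s ∈ formsAlg E U) :
    RawForm.res E h s ∈ formsAlg E V := by
  intro x hx
  obtain ⟨W, hW, hxW, hsW⟩ := hs x (h hx)
  exact ⟨V ⊓ W, inf_le_left, ⟨hx, hxW⟩, regular_res (inf_le_right : V ⊓ W ≤ W) hsW⟩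

variable (E) in
/-- Restriction of holomorphic forms. -/
def Forms.res {U V : Opens M} (h : V ≤ U) : Forms E U →ₐ[ℂ] Forms E V :=
  ((RawForm.res E h).comp (Forms.val E U)).codRestrict (formsAlg E V) fun s ↦ Forms_res h s.2

@[simp] theorem Forms.res_apply {U V : Opens M} (h : V ≤ U) (s : Forms E U) (x : V) :
    (Forms.res E h s).1 x = s.1 ⟨x.1, h x.2⟩ := rfl

variable (E) in
/-- The holomorphic function `f` on `V` as an element of `Ω(V)`. -/
def funForm (f : M → ℂ) {V : Opens M} (hf : IsHol E f V) : Forms E V :=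
  ⟨funField E f V, mem_Forms_of_regular (Algebra.subset_adjoin ⟨f, hf, Or.inl rfl⟩)⟩

variable (E) in
/-- The space `Ω^q(U)` of holomorphic forms of degree `q : ℤ` over `U`. -/
def FormsDeg (q : ℤ) (U : Opens M) : Submodule ℂ (Forms E U) where
  carrier := {s | ∀ x, s.1 x ∈ piece (Cot E x.1) q}
  add_mem' ha hb x := add_mem (ha x) (hb x)
  zero_mem' _ := zero_mem _
  smul_mem' c _ ha x := Submodule.smul_mem _ c (ha x)

/-! ### The exterior differential -/

open Filter Topology

variable (E) in
/-- The derivative at `x` of the chart at `x`. -/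
def chartDeriv (x : M) : TangentSpace 𝓘(ℂ, E) x →ₗ[ℂ] E :=
  (mfderiv 𝓘(ℂ, E) 𝓘(ℂ, E) (extChartAt 𝓘(ℂ, E) x) x).toLinearMap

variable (E) in
/-- The derivative at `z` of the inverse of the chart at `x`. -/
def chartSymmDeriv (x : M) (z : E) :
    E →ₗ[ℂ] TangentSpace 𝓘(ℂ, E) ((extChartAt 𝓘(ℂ, E) x).symm z) :=
  (mfderiv 𝓘(ℂ, E) 𝓘(ℂ, E) (extChartAt 𝓘(ℂ, E) x).symm z).toLinearMap

variable (E) in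
/-- The pullback of forms on `M` at the point with coordinates `z` to forms on `E` at `z` by the
inverse of the chart at `x`. -/
def chartSymmPull (x : M) (z : E) :
    ExteriorAlgebra ℂ (Cot E ((extChartAt 𝓘(ℂ, E) x).symm z)) →ₐ[ℂ]
      ExteriorAlgebra ℂ (Module.Dual ℂ E) :=
  ExteriorAlgebra.map (chartSymmDeriv E x z).dualMap

open Classical in
variable (E) in
/-- The expression in the chart at `x` of a form `s`, i.e. its pullback under the inverse
of the chart. -/
def localForm {U : Opens M} (s : RawForm E U) (x : M) (z : E) :
    ExteriorAlgebra ℂ (Module.Dual ℂ E) :=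
  if h : (extChartAt 𝓘(ℂ, E) x).symm z ∈ U then chartSymmPull E x z (s ⟨_, h⟩) else 0

variable (E) in
/-- The pullback of forms on `E` to forms on `M` at the point `x` by the chart at `x`. -/
def chartPull (x : M) : ExteriorAlgebra ℂ (Module.Dual ℂ E) →ₐ[ℂ] ExteriorAlgebra ℂ (Cot E x) :=
  ExteriorAlgebra.map (chartDeriv E x).dualMap

variable (E) in
/-- The exterior differential of a form: `(ds)(x)` is computed in the chart at `x`. -/
def extD [FiniteDimensional ℂ E] {U : Opens M} (s : RawForm E U) : RawForm E U := fun x ↦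
  chartPull E x.1 (flatD (localForm E s x.1) (extChartAt 𝓘(ℂ, E) x.1 x.1))

variable (E) in
/-- The parity involution of forms. -/
def RawForm.inv (U : Opens M) : RawForm E U →ₐ[ℂ] RawForm E U :=
  AlgHom.pi fun x ↦ AlgHom.comp (CliffordAlgebra.involute (Q := (0 : QuadraticForm ℂ (Cot E x.1))))
    (Pi.evalAlgHom ℂ (fun x : U ↦ ExteriorAlgebra ℂ (Cot E x.1)) x)

theorem regular_inv {V : Opens M} {a : RawForm E V} (ha : a ∈ regular E V) :
    RawForm.inv E V a ∈ regular E V := by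
  have : regular E V ≤ (regular E V).comap (RawForm.inv E V) := by
    refine Algebra.adjoin_le ?_
    rintro _ ⟨f, hf, rfl | rfl⟩
    · have : RawForm.inv E V (funField E f V) = funField E f V := by
        funext x
        exact AlgHom.commutes _ _
      exact (congrArg (· ∈ regular E V) this).mpr (Algebra.subset_adjoin ⟨f, hf, Or.inl rfl⟩)
    · have : RawForm.inv E V (diffField E f V) = - diffField E f V := by
        funext x
        exact CliffordAlgebra.involute_ι _
      exact (congrArg (· ∈ regular E V) this).mpr
        (neg_mem (Algebra.subset_adjoin ⟨f, hf, Or.inr rfl⟩))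
  exact this ha

section Local

theorem localForm_pos {U : Opens M} (s : RawForm E U) {x : M} {z : E}
    (h : (extChartAt 𝓘(ℂ, E) x).symm z ∈ U) :
    localForm E s x z = chartSymmPull E x z (s ⟨_, h⟩) := dif_pos h

theorem localForm_neg {U : Opens M} (s : RawForm E U) {x : M} {z : E}
    (h : (extChartAt 𝓘(ℂ, E) x).symm z ∉ U) : localForm E s x z = 0 := dif_neg h

theorem eventually_symm_mem {U : Opens M} {x : M} (hx : x ∈ U) :
    ∀ᶠ z in 𝓝 (extChartAt 𝓘(ℂ, E) x x), (extChartAt 𝓘(ℂ, E) x).symm z ∈ U := by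
  have := continuousAt_extChartAt_symm (I := 𝓘(ℂ, E)) x
  refine this.eventually_mem ?_
  rw [extChartAt_to_inv]
  exact U.isOpen.mem_nhds hx

theorem localForm_res {U V : Opens M} (h : V ≤ U) (s : RawForm E U) {x : M} (hx : x ∈ V) :
    localForm E (RawForm.res E h s) x =ᶠ[𝓝 (extChartAt 𝓘(ℂ, E) x x)] localForm E s x := by
  filter_upwards [eventually_symm_mem hx] with z hz
  rw [localForm_pos _ hz, localForm_pos _ (h hz), RawForm.res_apply]

theorem localForm_add {U : Opens M} (s t : RawForm E U) (x : M) :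
    localForm E (s + t) x = fun z ↦ localForm E s x z + localForm E t x z := by
  funext z
  by_cases h : (extChartAt 𝓘(ℂ, E) x).symm z ∈ U
  · simp only [localForm_pos _ h, Pi.add_apply, map_add]
  · simp [localForm_neg _ h]

theorem localForm_smul {U : Opens M} (c : ℂ) (s : RawForm E U) (x : M) :
    localForm E (c • s) x = fun z ↦ c • localForm E s x z := by
  funext z
  by_cases h : (extChartAt 𝓘(ℂ, E) x).symm z ∈ U
  · simp only [localForm_pos _ h, Pi.smul_apply, map_smul]
  · simp [localForm_neg _ h]

theorem localForm_mul {U : Opens M} (s t : RawForm E U) (x : M) :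
    localForm E (s * t) x = fun z ↦ localForm E s x z * localForm E t x z := by
  funext z
  by_cases h : (extChartAt 𝓘(ℂ, E) x).symm z ∈ U
  · simp only [localForm_pos _ h, Pi.mul_apply, map_mul]
  · simp [localForm_neg _ h]

theorem localForm_funField (f : M → ℂ) {V : Opens M} {x : M} (hx : x ∈ V) :
    localForm E (funField E f V) x =ᶠ[𝓝 (extChartAt 𝓘(ℂ, E) x x)]
      fun z ↦ algebraMap ℂ _ (f ((extChartAt 𝓘(ℂ, E) x).symm z)) := by
  filter_upwards [eventually_symm_mem hx] with z hz
  rw [localForm_pos _ hz, funField, AlgHom.commutes]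

variable [IsManifold 𝓘(ℂ, E) ω M]

theorem IsHol.contDiffAt {f : M → ℂ} {V : Opens M} (hf : IsHol E f V) {x : M} (hx : x ∈ V) :
    ContDiffAt ℂ ω (fun z ↦ f ((extChartAt 𝓘(ℂ, E) x).symm z)) (extChartAt 𝓘(ℂ, E) x x) := by
  rw [← contMDiffAt_iff_contDiffAt]
  have h1 : ContMDiffAt 𝓘(ℂ, E) 𝓘(ℂ, ℂ) ω f ((extChartAt 𝓘(ℂ, E) x).symm
      (extChartAt 𝓘(ℂ, E) x x)) := by
    rw [extChartAt_to_inv]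
    exact hf.contMDiffAt (V.isOpen.mem_nhds hx)
  have h2 : ContMDiffAt 𝓘(ℂ, E) 𝓘(ℂ, E) ω (extChartAt 𝓘(ℂ, E) x).symm
      (extChartAt 𝓘(ℂ, E) x x) :=
    (contMDiffOn_extChartAt_symm x).contMDiffAt (extChartAt_target_mem_nhds x)
  exact h1.comp _ h2

theorem localForm_diffField {f : M → ℂ} {V : Opens M} (hf : IsHol E f V) {x : M} (hx : x ∈ V) :
    localForm E (diffField E f V) x =ᶠ[𝓝 (extChartAt 𝓘(ℂ, E) x x)]
      fun z ↦ ExteriorAlgebra.ι ℂ (grad (fun z ↦ f ((extChartAt 𝓘(ℂ, E) x).symm z)) z) := by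
  filter_upwards [eventually_symm_mem hx, extChartAt_target_mem_nhds (I := 𝓘(ℂ, E)) x]
    with z hz hzt
  rw [localForm_pos _ hz, diffField, chartSymmPull, ExteriorAlgebra.map_apply_ι]
  congr 1
  have h1 : MDifferentiableAt 𝓘(ℂ, E) 𝓘(ℂ, ℂ) f ((extChartAt 𝓘(ℂ, E) x).symm z) :=
    (hf.contMDiffAt (V.isOpen.mem_nhds hz)).mdifferentiableAt (by simp)
  have h2 : MDifferentiableAt 𝓘(ℂ, E) 𝓘(ℂ, E) (extChartAt 𝓘(ℂ, E) x).symm z :=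
    ((contMDiffOn_extChartAt_symm (n := ω) x).contMDiffAt
      ((isOpen_extChartAt_target x).mem_nhds hzt)).mdifferentiableAt (by simp)
  have h3 := mfderiv_comp z h1 h2
  rw [mfderiv_eq_fderiv] at h3
  ext v
  exact (DFunLike.congr_fun h3 v).symm

theorem map_dualMap_of_eq {U : Opens M} (s : RawForm E U) {x y : M} (e : y = x) (hx : x ∈ U)
    (hy : y ∈ U) (C : TangentSpace 𝓘(ℂ, E) x →ₗ[ℂ] TangentSpace 𝓘(ℂ, E) y)
    (hC : ∀ v : E, (show E from C (show TangentSpace 𝓘(ℂ, E) x from v)) = v) :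
    ExteriorAlgebra.map C.dualMap (s ⟨y, hy⟩) = s ⟨x, hx⟩ := by
  subst e
  have : C.dualMap = LinearMap.id := by
    ext ξ v
    exact congrArg ξ (hC v)
  rw [this, ExteriorAlgebra.map_id]
  rfl

theorem chartPull_localForm {U : Opens M} (s : RawForm E U) (x : U) :
    chartPull E x.1 (localForm E s x.1 (extChartAt 𝓘(ℂ, E) x.1 x.1)) = s x := by
  have e : (extChartAt 𝓘(ℂ, E) x.1).symm (extChartAt 𝓘(ℂ, E) x.1 x.1) = x.1 := extChartAt_to_inv _
  have hy : (extChartAt 𝓘(ℂ, E) x.1).symm (extChartAt 𝓘(ℂ, E) x.1 x.1) ∈ U := by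
    rw [e]; exact x.2
  rw [localForm_pos _ hy, chartPull, chartSymmPull, ← AlgHom.comp_apply,
    ExteriorAlgebra.map_comp_map, LinearMap.dualMap_comp_dualMap]
  refine map_dualMap_of_eq s e x.2 hy _ fun v ↦ ?_
  have h1 : MDifferentiableAt 𝓘(ℂ, E) 𝓘(ℂ, E) (extChartAt 𝓘(ℂ, E) x.1) x.1 :=
    (contMDiffAt_extChartAt (n := ω)).mdifferentiableAt (by simp)
  have h2 : MDifferentiableAt 𝓘(ℂ, E) 𝓘(ℂ, E) (extChartAt 𝓘(ℂ, E) x.1).symm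
      (extChartAt 𝓘(ℂ, E) x.1 x.1) :=
    ((contMDiffOn_extChartAt_symm (n := ω) x.1).contMDiffAt
      (extChartAt_target_mem_nhds _)).mdifferentiableAt (by simp)
  have h3 := mfderiv_comp x.1 h2 h1
  have h4 : (extChartAt 𝓘(ℂ, E) x.1).symm ∘ (extChartAt 𝓘(ℂ, E) x.1) =ᶠ[𝓝 x.1] id := by
    filter_upwards [extChartAt_source_mem_nhds (I := 𝓘(ℂ, E)) x.1] with y hy
    exact (extChartAt 𝓘(ℂ, E) x.1).left_inv hy
  have h5 := h4.mfderiv_eq (I := 𝓘(ℂ, E)) (I' := 𝓘(ℂ, E))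
  rw [mfderiv_id] at h5
  exact (DFunLike.congr_fun (h3.symm.trans h5) v)

variable [FiniteDimensional ℂ E]

theorem extD_res {U V : Opens M} (h : V ≤ U) (s : RawForm E U) :
    extD E (RawForm.res E h s) = RawForm.res E h (extD E s) := by
  funext x
  exact congrArg _ (flatD_congr (localForm_res h s x.2))

/-- All coefficients of the form `s` in the chart at `x` are differentiable at `x`. -/
def FieldDiff {U : Opens M} (s : RawForm E U) (x : M) : Prop :=
  CoefDiff (localForm E s x) (extChartAt 𝓘(ℂ, E) x x)

theorem extD_add {U : Opens M} {s t : RawForm E U} (hs : ∀ x ∈ U, FieldDiff s x)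
    (ht : ∀ x ∈ U, FieldDiff t x) : extD E (s + t) = extD E s + extD E t := by
  funext x
  simp only [extD, localForm_add, Pi.add_apply]
  rw [flatD_add (hs _ x.2) (ht _ x.2), map_add]

theorem extD_smul {U : Opens M} (c : ℂ) (s : RawForm E U) : extD E (c • s) = c • extD E s := by
  funext x
  simp only [extD, localForm_smul, Pi.smul_apply]
  rw [flatD_smul, map_smul]

theorem extD_mul {U : Opens M} {s t : RawForm E U} (hs : ∀ x ∈ U, FieldDiff s x)
    (ht : ∀ x ∈ U, FieldDiff t x) :
    extD E (s * t) = extD E s * t + RawForm.inv E U s * extD E t := by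
  funext x
  simp only [extD, localForm_mul, Pi.add_apply, Pi.mul_apply]
  rw [flatD_mul (hs _ x.2) (ht _ x.2), map_add, map_mul, map_mul, chartPull_localForm,
    chartPull, map_involute, ← chartPull, chartPull_localForm]
  rfl

theorem extD_funField {f : M → ℂ} {V : Opens M} (hf : IsHol E f V) :
    extD E (funField E f V) = diffField E f V := by
  funext x
  have h0 : DifferentiableAt ℂ (fun z ↦ f ((extChartAt 𝓘(ℂ, E) x.1).symm z))
    (extChartAt 𝓘(ℂ, E) x.1 x.1) := (hf.contDiffAt x.2).differentiableAt (by simp)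
  rw [extD, flatD_congr (localForm_funField f x.2), flatD_algebraMap h0,
    ← (localForm_diffField hf x.2).eq_of_nhds, chartPull_localForm]

theorem extD_diffField {f : M → ℂ} {V : Opens M} (hf : IsHol E f V) :
    extD E (diffField E f V) = 0 := by
  funext x
  rw [extD, flatD_congr (localForm_diffField hf x.2),
    flatD_iota_grad ((hf.contDiffAt x.2).of_le le_top), map_zero]
  rfl

theorem regular_extD {V : Opens M} {a : RawForm E V} (ha : a ∈ regular E V) :
    (∀ x ∈ V, FieldDiff a x) ∧ extD E a ∈ regular E V := by
  have base : ∀ f, IsHol E f V → (∀ x ∈ V, FieldDiff (funField E f V) x) ∧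
      extD E (funField E f V) ∈ regular E V := by
    intro f hf
    refine ⟨fun x hx ↦ (coefDiff_algebraMap ((hf.contDiffAt hx).differentiableAt (by simp))).congr
      (localForm_funField f hx), ?_⟩
    rw [extD_funField hf]
    exact Algebra.subset_adjoin ⟨f, hf, Or.inr rfl⟩
  induction ha using Algebra.adjoin_induction with
  | mem a ha =>
    obtain ⟨f, hf, rfl | rfl⟩ := ha
    · exact base f hf
    · refine ⟨fun x hx ↦ (coefDiff_iota_grad ((hf.contDiffAt hx).of_le le_top)).congr
        (localForm_diffField hf hx), ?_⟩
      rw [extD_diffField hf]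
      exact zero_mem _
  | algebraMap r => exact base (fun _ ↦ r) contMDiffOn_const
  | add a b ha hb iha ihb =>
    refine ⟨fun x hx ↦ ?_, ?_⟩
    · have := coefDiff_add (iha.1 x hx) (ihb.1 x hx)
      rwa [← localForm_add] at this
    · rw [extD_add iha.1 ihb.1]
      exact add_mem iha.2 ihb.2
  | mul a b ha hb iha ihb =>
    refine ⟨fun x hx ↦ ?_, ?_⟩
    · have := coefDiff_mul (iha.1 x hx) (ihb.1 x hx)
      rwa [← localForm_mul] at this
    · rw [extD_mul iha.1 ihb.1]
      exact add_mem (mul_mem iha.2 hb) (mul_mem (regular_inv ha) ihb.2)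

theorem Forms_fieldDiff {U : Opens M} {s : RawForm E U} (hs : s ∈ formsAlg E U) :
    ∀ x ∈ U, FieldDiff s x := by
  intro x hx
  obtain ⟨V, hV, hxV, h⟩ := hs x hx
  exact ((regular_extD h).1 x hxV).congr (localForm_res hV s hxV).symm

theorem Forms_extD {U : Opens M} {s : RawForm E U} (hs : s ∈ formsAlg E U) :
    extD E s ∈ formsAlg E U := by
  intro x hx
  obtain ⟨V, hV, hxV, h⟩ := hs x hx
  refine ⟨V, hV, hxV, ?_⟩
  rw [← extD_res]
  exact (regular_extD h).2

theorem extD_mem_piece {q : ℤ} {U : Opens M} {s : RawForm E U} (hs : s ∈ formsAlg E U)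
    (h : ∀ x, s x ∈ piece _ q) (x : U) : extD E s x ∈ piece _ (q + 1) := by
  rw [add_comm]
  refine map_mem_piece _ (flatD_mem_piece (Forms_fieldDiff hs _ x.2) ?_)
  filter_upwards [eventually_symm_mem (E := E) x.2] with z hz
  rw [localForm_pos _ hz]
  exact map_mem_piece _ (h _)

end Local


/-! ### Endomorphisms and derivations of the sheaf of forms -/

section Bracket

variable {R : Type*} [Ring R] [Algebra ℂ R]

/-- The supercommutator `[a, b] = ab - (-1)^{pq} ba` of operators of degrees `p` and `q`. -/
def superBracket (p q : ℤ) (a b : R) : R := a * b - ((-1 : ℂ) ^ (p * q)) • (b * a)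

theorem superBracket_add_left (p q : ℤ) (a a' b : R) :
    superBracket p q (a + a') b = superBracket p q a b + superBracket p q a' b := by
  simp only [superBracket, add_mul, mul_add, smul_add]
  abel

theorem superBracket_smul_left (p q : ℤ) (c : ℂ) (a b : R) :
    superBracket p q (c • a) b = c • superBracket p q a b := by
  simp only [superBracket, smul_mul_assoc, mul_smul_comm, smul_sub]
  rw [smul_comm]

theorem superBracket_zero_left (p q : ℤ) (b : R) : superBracket p q 0 b = 0 := by
  simp [superBracket]

theorem superBracket_leibniz {p q r : ℤ} (s t s₁ t₁ s₂ t₂ s₁₂ t₁₂ s₂₁ t₂₁ : R) :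
    (s₁₂ * t + ((-1 : ℂ) ^ (p * (r + q))) • (s₂ * t₁) +
        ((-1 : ℂ) ^ (q * r)) • (s₁ * t₂ + ((-1 : ℂ) ^ (p * r)) • (s * t₁₂))) -
      ((-1 : ℂ) ^ (p * q)) • (s₂₁ * t + ((-1 : ℂ) ^ (q * (r + p))) • (s₁ * t₂) +
        ((-1 : ℂ) ^ (p * r)) • (s₂ * t₁ + ((-1 : ℂ) ^ (q * r)) • (s * t₂₁))) =
    (s₁₂ - ((-1 : ℂ) ^ (p * q)) • s₂₁) * t +
      ((-1 : ℂ) ^ ((p + q) * r)) • (s * (t₁₂ - ((-1 : ℂ) ^ (p * q)) • t₂₁)) := by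
  have e1 : (-1 : ℂ) ^ (p * (r + q)) = (-1 : ℂ) ^ (p * q) * (-1 : ℂ) ^ (p * r) := by
    rw [← zpow_add₀ (by norm_num)]
    congr 1
    ring
  have e2 : (-1 : ℂ) ^ (p * q) * (-1 : ℂ) ^ (q * (r + p)) = (-1 : ℂ) ^ (q * r) := by
    rw [← zpow_add₀ (by norm_num)]
    have : p * q + q * (r + p) = 2 * (p * q) + q * r := by ring
    rw [this, zpow_add₀ (by norm_num), zpow_mul]
    norm_num
  have e3 : (-1 : ℂ) ^ ((p + q) * r) = (-1 : ℂ) ^ (p * r) * (-1 : ℂ) ^ (q * r) := by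
    rw [← zpow_add₀ (by norm_num)]
    congr 1
    ring
  simp only [smul_add, smul_smul, sub_mul, mul_sub, smul_sub, e2, smul_mul_assoc, mul_smul_comm]
  rw [e1, e3]
  module

end Bracket

section Derivations

variable (E) in
/-- The algebra of `ℂ`-linear endomorphisms of the sheaf `Ω` restricted to the open set `U`, as a
subalgebra:
families of endomorphisms of `Ω(V)`, for `V ⊆ U`, which commute with restrictions. -/
def sheafEndAlg (U : Opens M) :
    Subalgebra ℂ (∀ V : {V : Opens M // V ≤ U}, Module.End ℂ (Forms E V.1)) where
  carrier := {δ | ∀ (V W : {V : Opens M // V ≤ U}) (h : V.1 ≤ W.1) (s : Forms E W.1),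
    δ V (Forms.res E h s) = Forms.res E h (δ W s)}
  mul_mem' := by
    intro a b ha hb V W h s
    simp only [Pi.mul_apply, Module.End.mul_apply]
    rw [hb, ha]
  add_mem' := by
    intro a b ha hb V W h s
    simp only [Pi.add_apply, LinearMap.add_apply]
    rw [hb, ha, map_add]
  algebraMap_mem' := by
    intro r V W h s
    simp [Pi.algebraMap_apply, Module.algebraMap_end_apply]

variable (E) in
/-- The algebra of `ℂ`-linear endomorphisms of the sheaf `Ω` restricted to the open set `U`. -/
def SheafEnd (U : Opens M) : Type _ := sheafEndAlg E U

instance (U : Opens M) : Ring (SheafEnd E U) := inferInstanceAs (Ring (sheafEndAlg E U))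
instance (U : Opens M) : Algebra ℂ (SheafEnd E U) := inferInstanceAs (Algebra ℂ (sheafEndAlg E U))

variable (E) in
/-- The action of a section over `U` of the sheaf of endomorphisms on forms over `V ⊆ U`. -/
def SheafEnd.app {U : Opens M} (δ : SheafEnd E U) {V : Opens M} (hV : V ≤ U) :
    Module.End ℂ (Forms E V) := δ.1 ⟨V, hV⟩

variable (E) in
/-- Restriction of endomorphisms to smaller open sets. -/
def SheafEnd.res {U U' : Opens M} (h : U' ≤ U) : SheafEnd E U →ₗ[ℂ] SheafEnd E U' where
  toFun δ := ⟨fun V ↦ δ.1 ⟨V.1, V.2.trans h⟩, fun V W hVW s ↦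
    δ.2 ⟨V.1, V.2.trans h⟩ ⟨W.1, W.2.trans h⟩ hVW s⟩
  map_add' _ _ := rfl
  map_smul' _ _ := rfl

variable (E) in
/-- The sections over `U` of the sheaf `Der_p Ω`: the endomorphisms `δ` of the sheaf `Ω` on `U`,
homogeneous of degree `p`, such that `δ(st) = δ(s)t + (-1)^{pq} s δ(t)` for `s` of degree `q`. -/
def Der (p : ℤ) (U : Opens M) : Submodule ℂ (SheafEnd E U) where
  carrier := {δ | ∀ (V : Opens M) (hV : V ≤ U) (q : ℤ), ∀ s ∈ FormsDeg E q V,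
    SheafEnd.app E δ hV s ∈ FormsDeg E (q + p) V ∧
    ∀ t : Forms E V, SheafEnd.app E δ hV (s * t) =
      SheafEnd.app E δ hV s * t + ((-1 : ℂ) ^ (p * q)) • (s * SheafEnd.app E δ hV t)}
  add_mem' := by
    intro a b ha hb V hV q s hs
    refine ⟨add_mem (ha V hV q s hs).1 (hb V hV q s hs).1, fun t ↦ ?_⟩
    have h1 := (ha V hV q s hs).2 t
    have h2 := (hb V hV q s hs).2 t
    change SheafEnd.app E a hV (s * t) + SheafEnd.app E b hV (s * t) =
      (SheafEnd.app E a hV s + SheafEnd.app E b hV s) * t +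
      ((-1 : ℂ) ^ (p * q)) • (s * (SheafEnd.app E a hV t + SheafEnd.app E b hV t))
    rw [h1, h2, add_mul, mul_add, smul_add]
    abel
  zero_mem' := by
    intro V hV q s hs
    refine ⟨zero_mem _, fun t ↦ ?_⟩
    change (0 : Forms E V) = 0 * t + ((-1 : ℂ) ^ (p * q)) • (s * (0 : Forms E V))
    simp
  smul_mem' := by
    intro c a ha V hV q s hs
    refine ⟨Submodule.smul_mem _ c (ha V hV q s hs).1, fun t ↦ ?_⟩
    have h1 := (ha V hV q s hs).2 t
    change c • SheafEnd.app E a hV (s * t) = (c • SheafEnd.app E a hV s) * t +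
      ((-1 : ℂ) ^ (p * q)) • (s * (c • SheafEnd.app E a hV t))
    rw [h1, smul_add, smul_mul_assoc, mul_smul_comm, smul_comm]

variable (E) in
/-- Restriction of derivations to smaller open sets. -/
def Der.res (p : ℤ) {U U' : Opens M} (h : U' ≤ U) : Der E p U →ₗ[ℂ] Der E p U' :=
  (SheafEnd.res E h ∘ₗ (Der E p U).subtype).codRestrict _ fun δ V hV q s hs ↦
    δ.2 V (hV.trans h) q s hs

theorem SheafEnd.mul_app {U : Opens M} (a b : SheafEnd E U) {V : Opens M} (hV : V ≤ U)
    (s : Forms E V) :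
    SheafEnd.app E (a * b) hV s = SheafEnd.app E a hV (SheafEnd.app E b hV s) := rfl

theorem superBracket_app {U : Opens M} (p q : ℤ) (a b : SheafEnd E U) {V : Opens M} (hV : V ≤ U)
    (s : Forms E V) :
    SheafEnd.app E (superBracket p q a b) hV s = SheafEnd.app E a hV (SheafEnd.app E b hV s) -
      ((-1 : ℂ) ^ (p * q)) • SheafEnd.app E b hV (SheafEnd.app E a hV s) := rfl

theorem superBracket_mem {U : Opens M} {p q : ℤ} {a b : SheafEnd E U} (ha : a ∈ Der E p U)
    (hb : b ∈ Der E q U) : superBracket p q a b ∈ Der E (p + q) U := by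
  intro V hV r s hs
  obtain ⟨ha1, ha2⟩ := ha V hV r s hs
  obtain ⟨hb1, hb2⟩ := hb V hV r s hs
  have hab := ha V hV _ _ hb1
  have hba := hb V hV _ _ ha1
  refine ⟨?_, fun t ↦ ?_⟩
  · rw [superBracket_app]
    refine sub_mem ?_ (Submodule.smul_mem _ _ ?_)
    · convert hab.1 using 1
      congr 1
      ring
    · convert hba.1 using 1
      congr 1
      ring
  · rw [superBracket_app, superBracket_app, superBracket_app, hb2, ha2, map_add, map_smul,
      map_add, map_smul, hab.2, hba.2, ha2, hb2]
    exact superBracket_leibniz _ _ _ _ _ _ _ _ _ _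

variable [IsManifold 𝓘(ℂ, E) ω M]

variable (E) in
/-- The exterior differential as a section of the sheaf of endomorphisms of `Ω` over `U`. -/
def extDiff [FiniteDimensional ℂ E] (U : Opens M) : SheafEnd E U where
  val _ :=
    { toFun := fun s ↦ ⟨extD E s.1, Forms_extD s.2⟩
      map_add' := fun s t ↦ Subtype.ext (extD_add (Forms_fieldDiff s.2) (Forms_fieldDiff t.2))
      map_smul' := fun c s ↦ Subtype.ext (extD_smul c s.1) }
  property _ _ h s := Subtype.ext (extD_res h s.1)

theorem extDiff_mem_Der [FiniteDimensional ℂ E] (U : Opens M) : extDiff E U ∈ Der E 1 U := by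
  intro V hV q s hs
  refine ⟨fun x ↦ extD_mem_piece s.2 hs x, fun t ↦ Subtype.ext ?_⟩
  refine (extD_mul (Forms_fieldDiff s.2) (Forms_fieldDiff t.2)).trans ?_
  change _ = extD E s.1 * t.1 + ((-1 : ℂ) ^ (1 * q)) • (s.1 * extD E t.1)
  congr 1
  funext x
  have := involute_of_mem_piece (hs x)
  rw [one_mul]
  change CliffordAlgebra.involute (s.1 x) * extD E t.1 x =
    ((-1 : ℂ) ^ q) • (s.1 x * extD E t.1 x)
  rw [this, smul_mul_assoc]

end Derivations

/-! ### Vector-valued forms -/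

section VectorForms

variable (E) in
/-- Arbitrary sections over `U` of the tensor product of the tangent bundle and the exterior
algebra of the cotangent bundle. -/
abbrev RawVecForm (U : Opens M) : Type _ :=
  ∀ x : U, TangentSpace 𝓘(ℂ, E) x.1 ⊗[ℂ] ExteriorAlgebra ℂ (Cot E x.1)

variable (E) in
/-- Restriction of vector-valued forms. -/
def RawVecForm.res {U V : Opens M} (h : V ≤ U) : RawVecForm E U →ₗ[ℂ] RawVecForm E V :=
  LinearMap.pi fun x ↦ LinearMap.proj (φ := fun x : U ↦
    TangentSpace 𝓘(ℂ, E) x.1 ⊗[ℂ] ExteriorAlgebra ℂ (Cot E x.1)) ⟨x.1, h x.2⟩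

variable (E) in
/-- The vector field `v` is holomorphic on `V`. -/
def IsHolVector [IsManifold 𝓘(ℂ, E) ω M] (v : ∀ x : M, TangentSpace 𝓘(ℂ, E) x)
    (V : Opens M) : Prop :=
  ContMDiffOn 𝓘(ℂ, E) 𝓘(ℂ, E).tangent ω
    (fun x ↦ (⟨x, v x⟩ : TangentBundle 𝓘(ℂ, E) M)) V

variable (E) in
/-- Finite sums over `V` of tensors `v ⊗ η`, with `v` a holomorphic vector field on `V` and `η` a
holomorphic form of degree `p` over `V`. -/
def vecRegular [IsManifold 𝓘(ℂ, E) ω M] (p : ℤ) (V : Opens M) : Submodule ℂ (RawVecForm E V) :=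
  Submodule.span ℂ {τ | ∃ v, IsHolVector E v V ∧ ∃ η ∈ FormsDeg E p V,
    τ = fun x ↦ v x.1 ⊗ₜ[ℂ] η.1 x}

variable [IsManifold 𝓘(ℂ, E) ω M]

theorem vecRegular_res {p : ℤ} {U V : Opens M} (h : V ≤ U) {τ : RawVecForm E U}
    (hτ : τ ∈ vecRegular E p U) : RawVecForm.res E h τ ∈ vecRegular E p V := by
  have : vecRegular E p U ≤ (vecRegular E p V).comap (RawVecForm.res E h) := by
    refine Submodule.span_le.mpr ?_
    rintro _ ⟨v, hv, η, hη, rfl⟩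
    exact Submodule.subset_span ⟨v, hv.mono h, Forms.res E h η, fun x ↦ hη _, rfl⟩
  exact this hτ

variable (E) in
/-- The space of sections over `U` of the sheaf `T ⊗ Ω^p` of holomorphic vector-valued
`p`-forms: the sections which are locally finite sums of tensors `v ⊗ η`. -/
def VecForms (p : ℤ) (U : Opens M) : Submodule ℂ (RawVecForm E U) where
  carrier := {τ | ∀ x ∈ U, ∃ (V : Opens M) (h : V ≤ U),
    x ∈ V ∧ RawVecForm.res E h τ ∈ vecRegular E p V}
  add_mem' := by
    intro a b ha hb x hx
    obtain ⟨V, hV, hxV, haV⟩ := ha x hx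
    obtain ⟨W, hW, hxW, hbW⟩ := hb x hx
    refine ⟨V ⊓ W, inf_le_left.trans hV, ⟨hxV, hxW⟩, ?_⟩
    rw [map_add]
    exact add_mem (vecRegular_res inf_le_left haV) (vecRegular_res inf_le_right hbW)
  zero_mem' x hx := ⟨U, le_rfl, hx, by rw [map_zero]; exact zero_mem _⟩
  smul_mem' := by
    intro c a ha x hx
    obtain ⟨V, hV, hxV, haV⟩ := ha x hx
    exact ⟨V, hV, hxV, by rw [map_smul]; exact Submodule.smul_mem _ c haV⟩

theorem VecForms_res {p : ℤ} {U V : Opens M} (h : V ≤ U) {τ : RawVecForm E U}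
    (hτ : τ ∈ VecForms E p U) : RawVecForm.res E h τ ∈ VecForms E p V := by
  intro x hx
  obtain ⟨W, hW, hxW, hsW⟩ := hτ x (h hx)
  exact ⟨V ⊓ W, inf_le_left, ⟨hx, hxW⟩, vecRegular_res (inf_le_right : V ⊓ W ≤ W) hsW⟩

variable (E) in
/-- Restriction of holomorphic vector-valued forms. -/
def VecForms.res (p : ℤ) {U V : Opens M} (h : V ≤ U) : VecForms E p U →ₗ[ℂ] VecForms E p V :=
  (RawVecForm.res E h ∘ₗ (VecForms E p U).subtype).codRestrict _ fun τ ↦ VecForms_res h τ.2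

theorem vecRegular_mem_vecPiece {p : ℤ} {V : Opens M} {τ : RawVecForm E V}
    (hτ : τ ∈ vecRegular E p V) (x : V) : τ x ∈ vecPiece (TangentSpace 𝓘(ℂ, E) x.1) p := by
  induction hτ using Submodule.span_induction with
  | mem τ hτ =>
    obtain ⟨v, hv, η, hη, rfl⟩ := hτ
    exact Submodule.subset_span ⟨_, _, hη x, rfl⟩
  | zero => exact zero_mem _
  | add a b _ _ ha hb => exact add_mem ha hb
  | smul c a _ ha => exact Submodule.smul_mem _ c ha

theorem VecForms_mem_vecPiece {p : ℤ} {U : Opens M} {τ : RawVecForm E U}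
    (hτ : τ ∈ VecForms E p U) (x : U) : τ x ∈ vecPiece (TangentSpace 𝓘(ℂ, E) x.1) p := by
  obtain ⟨V, hV, hxV, h⟩ := hτ x.1 x.2
  exact vecRegular_mem_vecPiece h ⟨x.1, hxV⟩

/-! ### The operators defined by vector-valued forms -/

theorem IsHolVector.apply {v : ∀ x : M, TangentSpace 𝓘(ℂ, E) x} {f : M → ℂ} {V : Opens M}
    (hv : IsHolVector E v V) (hf : IsHol E f V) :
    IsHol E (fun x ↦ differential E f x (v x)) V := by
  have h1 : ContMDiffOn 𝓘(ℂ, E).tangent 𝓘(ℂ, ℂ).tangent ω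
      (tangentMapWithin 𝓘(ℂ, E) 𝓘(ℂ, ℂ) f V)
      (Bundle.TotalSpace.proj ⁻¹' (V : Set M)) :=
    ContMDiffOn.contMDiffOn_tangentMapWithin hf (by simp) V.isOpen.uniqueMDiffOn
  have h2 := h1.comp hv (fun y hy ↦ hy)
  have h3 := (contMDiff_snd_tangentBundle_modelSpace ℂ 𝓘(ℂ, ℂ) (n := ω)).comp_contMDiffOn h2
  refine h3.congr fun y hy ↦ ?_
  change (mfderiv 𝓘(ℂ, E) 𝓘(ℂ, ℂ) f y) (v y) = (mfderivWithin 𝓘(ℂ, E) 𝓘(ℂ, ℂ) f V y) (v y)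
  rw [mfderivWithin_of_isOpen V.isOpen hy]

theorem contract_regular {v : ∀ x : M, TangentSpace 𝓘(ℂ, E) x} {V : Opens M}
    (hv : IsHolVector E v V) {a : RawForm E V} (ha : a ∈ regular E V) :
    (fun x ↦ contract (v x.1) (a x) : RawForm E V) ∈ regular E V := by
  have hfun : ∀ f, IsHol E f V → funField E f V ∈ regular E V := fun f hf ↦
    Algebra.subset_adjoin ⟨f, hf, Or.inl rfl⟩
  induction ha using Algebra.adjoin_induction with
  | mem a ha =>
    obtain ⟨f, hf, rfl | rfl⟩ := ha
    · have : (fun x ↦ contract (v x.1) (funField E f V x) : RawForm E V) = 0 := by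
        funext x
        exact contract_algebraMap _ _
      rw [this]
      exact zero_mem _
    · have : (fun x ↦ contract (v x.1) (diffField E f V x) : RawForm E V) =
          funField E (fun x ↦ differential E f x (v x)) V := by
        funext x
        exact contract_iota _ _
      rw [this]
      exact hfun _ (hv.apply hf)
  | algebraMap r =>
    have : (fun x ↦ contract (v x.1) (algebraMap ℂ (RawForm E V) r x) : RawForm E V) = 0 := by
      funext x
      exact contract_algebraMap _ _
    rw [this]
    exact zero_mem _
  | add a b ha hb iha ihb =>
    have := add_mem iha ihb
    convert this using 1
    funext x
    exact map_add _ _ _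
  | mul a b ha hb iha ihb =>
    have := add_mem (mul_mem iha hb) (mul_mem (regular_inv ha) ihb)
    convert this using 1
    funext x
    exact contract_mul _ _ _

theorem insert_regular {p : ℤ} {V : Opens M} {τ : RawVecForm E V} (hτ : τ ∈ vecRegular E p V)
    {a : RawForm E V} (ha : a ∈ regular E V) :
    (fun x ↦ insertFibre (τ x) (a x) : RawForm E V) ∈ formsAlg E V := by
  induction hτ using Submodule.span_induction with
  | mem τ hτ =>
    obtain ⟨v, hv, η, hη, rfl⟩ := hτ
    exact mul_mem η.2 (mem_Forms_of_regular (contract_regular hv ha))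
  | zero =>
    have : (fun x ↦ insertFibre ((0 : RawVecForm E V) x) (a x) : RawForm E V) = 0 := by
      funext x
      simp
    rw [this]
    exact zero_mem _
  | add τ σ _ _ hτ hσ =>
    have := add_mem hτ hσ
    convert this using 1
    funext x
    simp
  | smul c τ _ hτ =>
    have := Subalgebra.smul_mem _ hτ c
    convert this using 1
    funext x
    simp

theorem insert_Forms {p : ℤ} {U : Opens M} {τ : RawVecForm E U} (hτ : τ ∈ VecForms E p U)
    {a : RawForm E U} (ha : a ∈ formsAlg E U) :
    (fun x ↦ insertFibre (τ x) (a x) : RawForm E U) ∈ formsAlg E U := by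
  intro x hx
  obtain ⟨V, hV, hxV, haV⟩ := ha x hx
  obtain ⟨W, hW, hxW, hbW⟩ := hτ x hx
  have h := insert_regular (vecRegular_res (inf_le_right : V ⊓ W ≤ W) hbW)
    (regular_res (inf_le_left : V ⊓ W ≤ V) haV)
  obtain ⟨V', hV', hxV', h'⟩ := h x ⟨hxV, hxW⟩
  exact ⟨V', hV'.trans (inf_le_left.trans hV), hxV', h'⟩

variable (E) in
/-- The operator `i(ω)` on `Ω` defined by a vector-valued form `ω`:
`i(v ⊗ η) s = η ∧ (v ⌟ s)`. -/
def insertion (p : ℤ) (U : Opens M) : VecForms E p U →ₗ[ℂ] SheafEnd E U where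
  toFun τ :=
    ⟨fun V ↦
      { toFun := fun s ↦ ⟨fun x ↦ insertFibre (τ.1 ⟨x.1, V.2 x.2⟩) (s.1 x),
          insert_Forms (VecForms_res V.2 τ.2) s.2⟩
        map_add' := fun s t ↦ Subtype.ext (funext fun x ↦
          map_add (insertFibre (τ.1 ⟨x.1, V.2 x.2⟩)) (s.1 x) (t.1 x))
        map_smul' := fun c s ↦ Subtype.ext (funext fun x ↦
          map_smul (insertFibre (τ.1 ⟨x.1, V.2 x.2⟩)) c (s.1 x)) },
      fun _ _ _ _ ↦ rfl⟩
  map_add' τ σ := by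
    refine Subtype.ext (funext fun V ↦ LinearMap.ext fun s ↦ Subtype.ext (funext fun x ↦ ?_))
    exact LinearMap.congr_fun (map_add insertFibre _ _) _
  map_smul' c τ := by
    refine Subtype.ext (funext fun V ↦ LinearMap.ext fun s ↦ Subtype.ext (funext fun x ↦ ?_))
    exact LinearMap.congr_fun (map_smul insertFibre _ _) _

theorem insertion_mem_Der {p : ℤ} {U : Opens M} (τ : VecForms E p U) :
    insertion E p U τ ∈ Der E (p - 1) U := by
  intro V hV q s hs
  have hτ := fun x : V ↦ VecForms_mem_vecPiece τ.2 ⟨x.1, hV x.2⟩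
  exact ⟨fun x ↦ insertFibre_mem (hτ x) (hs x), fun t ↦
    Subtype.ext (funext fun x ↦ insertFibre_mul (hτ x) (hs x) (t.1 x))⟩

variable (E) in
/-- The map `i_p : T ⊗ Ω^{p+1} → Der_p Ω`, `ω ↦ i(ω)`. -/
def insertDer (p : ℤ) (U : Opens M) : VecForms E (p + 1) U →ₗ[ℂ] Der E p U :=
  (insertion E (p + 1) U).codRestrict _ fun τ ↦ by
    have := insertion_mem_Der τ
    rwa [add_sub_cancel_right] at this

variable (E) in
/-- The map `T ⊗ Ω^p → Der_p Ω`, `ω ↦ [i(ω), d]`. -/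
def splitting [FiniteDimensional ℂ E] (p : ℤ) (U : Opens M) : VecForms E p U →ₗ[ℂ] Der E p U where
  toFun τ := ⟨superBracket (p - 1) 1 (insertion E p U τ) (extDiff E U), by
    have := superBracket_mem (insertion_mem_Der τ) (extDiff_mem_Der U)
    rwa [sub_add_cancel] at this⟩
  map_add' τ σ := Subtype.ext <|
    (congrArg (superBracket (p - 1) 1 · _) (map_add _ τ σ)).trans (superBracket_add_left _ _ _ _ _)
  map_smul' c τ := Subtype.ext <|
    (congrArg (superBracket (p - 1) 1 · _) (map_smul _ c τ)).trans
      (superBracket_smul_left _ _ _ _ _)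

variable (E) in
/-- The centralizer of `d` in `Der_p Ω`: the derivations `δ` of degree `p` with `[δ, d] = 0`. -/
def diffCentralizer [FiniteDimensional ℂ E] (p : ℤ) (U : Opens M) : Submodule ℂ (Der E p U) where
  carrier := {δ | superBracket p 1 δ.1 (extDiff E U) = 0}
  add_mem' {a b} ha hb :=
    (superBracket_add_left p 1 a.1 b.1 (extDiff E U)).trans (by rw [ha, hb, add_zero])
  zero_mem' := superBracket_zero_left _ _ _
  smul_mem' c a ha :=
    (superBracket_smul_left p 1 c a.1 (extDiff E U)).trans (by rw [ha, smul_zero])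

end VectorForms

end Manifold

end
end HolForm

/-! Locally every form is a polynomial in functions f and differentials df, so a derivation of Ω is
determined by what it does to these (`Der.eq_zero`). The two kinds of values are governed by the two
summands of the decomposition.

On functions, δ is a derivation from 𝒪 to Ω^p. Hadamard's lemma writes f = f(y) + ∑ (z_j - z_j(y))
g_j near y with g_j holomorphic. The Leibniz rule and the vanishing of z_j - z_j(y) at y then give
δf = ∑ ∂_j f · δz_j at y (`Der.app_funForm_eq_sum_differential`). Thus δ acts on functions as the
vector-valued form ∑ ∂_j ⊗ δz_j. Since a vector-valued form is determined by its values on functions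
(`VecForms.ext_of_pairFibre`), these local expressions do not depend on the coordinates and define
α(δ) over any open set (`symbol`).

The operator i(ω) kills functions and satisfies i(ω) df = ω(f). Hence [i(ω), d] f = ω(f), so that ω
↦ [i(ω), d] splits α. The splitting is defined over every open set, which makes α surjective on all
sections and not only locally.

If α(δ) = 0, then [δ, d] f = δ df. With η = α([δ, d]), the derivations i(η) and δ agree on every f
and df, so they are equal (`exact_insertDer_symbol`). Exactness at the left end is the recovery of ω
from i(ω) df = ω(f).

Finally, d² = 0 makes [i(ω), d] commute with d. Conversely, a derivation that commutes with d and
kills functions also kills every df, so it is zero. Applied to δ - [i(α(δ)), d], this identifies the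
centralizer of d with the image of the splitting. -/

namespace HolForm

open Filter Topology

/-! ### Coordinates -/

section Coordinates

variable {E : Type*} [NormedAddCommGroup E] [NormedSpace ℂ E]

/-- Hadamard's lemma: an analytic function is, near `z`, its value at `z` plus an analytic family
of linear forms applied to the increment. -/
theorem exists_analyticAt_slope {f : E → ℂ} {z : E} (hf : AnalyticAt ℂ f z) :
    ∃ G : E → E →L[ℂ] ℂ, AnalyticAt ℂ G z ∧ ∀ᶠ w in 𝓝 z, f w = f z + G w (w - z) := by
  obtain ⟨P, r, hP⟩ := hf
  have hr : 0 < P.shift.radius := by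
    rw [P.radius_shift]
    exact hP.r_pos.trans_le hP.r_le
  have hG := (P.shift.hasFPowerSeriesOnBall hr).comp_sub z
  rw [zero_add] at hG
  refine ⟨fun w ↦ P.shift.sum (w - z), hG.analyticAt, ?_⟩
  -- This is the power series of w ↦ f z + G w (w - z). It turns out to be `P`, the series of f, and
  -- two sums of one series agree.
  have h1 := hG.unshift (z := f z)
  have h2 : P.shift.unshift (f z) = P := by
    ext n v
    cases n with
    | zero =>
      rw [← hP.coeff_zero v]
      rfl
    | succ n => simp [FormalMultilinearSeries.shift, FormalMultilinearSeries.unshift]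
  rw [h2] at h1
  filter_upwards [hP.hasFPowerSeriesAt.eventually_hasSum_sub,
    h1.hasFPowerSeriesAt.eventually_hasSum_sub] with w hw hw'
  exact hw.unique hw'

variable [FiniteDimensional ℂ E] {M : Type*} [TopologicalSpace M] [ChartedSpace E M]

variable (E) in
/-- The domain of the chart at `x`. -/
def chartDomain (x : M) : Opens M := ⟨(chartAt E x).source, (chartAt E x).open_source⟩

omit [NormedSpace ℂ E] [FiniteDimensional ℂ E] in
theorem mem_chartDomain (x : M) : x ∈ chartDomain E x := mem_chart_source E x

variable (E) in
/-- The coordinate functions of the chart at `x`. -/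
noncomputable def coordFun (x : M) (j : Fin (Module.finrank ℂ E)) (y : M) : ℂ :=
  (Module.finBasis ℂ E).coord j (extChartAt 𝓘(ℂ, E) x y)

variable [IsManifold 𝓘(ℂ, E) ω M]

variable (E) in
/-- The coordinate vector fields of the chart at `x`. -/
noncomputable def coordVec (x : M) (j : Fin (Module.finrank ℂ E)) :
    ∀ y : M, TangentSpace 𝓘(ℂ, E) y :=
  (trivializationAt E (TangentSpace 𝓘(ℂ, E)) x).localFrame (Module.finBasis ℂ E) j

theorem isHol_linear_extChartAt (x : M) (ℓ : E →ₗ[ℂ] ℂ) :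
    IsHol E (fun y ↦ ℓ (extChartAt 𝓘(ℂ, E) x y)) (chartDomain E x) := by
  have h : ContMDiff 𝓘(ℂ, E) 𝓘(ℂ, ℂ) ω ℓ := ℓ.toContinuousLinearMap.contMDiff
  exact h.comp_contMDiffOn (contMDiffOn_extChartAt (I := 𝓘(ℂ, E)) (x := x))

theorem isHol_coordFun (x : M) (j) : IsHol E (coordFun E x j) (chartDomain E x) :=
  isHol_linear_extChartAt x _

/-- On the chart domain the trivialization of the tangent bundle is the derivative of the chart, so
this is the chain rule. A general ℓ serves both the coordinate functions and the realization of an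
arbitrary covector. -/
theorem differential_linear_extChartAt (x : M) (ℓ : E →ₗ[ℂ] ℂ) {y : M} (hy : y ∈ chartDomain E x)
    (v : TangentSpace 𝓘(ℂ, E) y) :
    differential E (fun y ↦ ℓ (extChartAt 𝓘(ℂ, E) x y)) y v =
      ℓ ((trivializationAt E (TangentSpace 𝓘(ℂ, E)) x).continuousLinearMapAt ℂ y v) := by
  rw [TangentBundle.continuousLinearMapAt_trivializationAt hy]
  have h1 : MDifferentiableAt 𝓘(ℂ, E) 𝓘(ℂ, E) (extChartAt 𝓘(ℂ, E) x) y :=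
    (contMDiffAt_extChartAt' (n := ω) hy).mdifferentiableAt (by simp)
  have h2 : MDifferentiableAt 𝓘(ℂ, E) 𝓘(ℂ, ℂ) ℓ.toContinuousLinearMap
      (extChartAt 𝓘(ℂ, E) x y) := ℓ.toContinuousLinearMap.mdifferentiableAt
  have h3 := mfderiv_comp y h2 h1
  rw [ContinuousLinearMap.mfderiv_eq] at h3
  exact DFunLike.congr_fun h3 v

/-- The trivialization carries the frame to the basis of E from which the coordinates are taken. -/
theorem differential_coordFun_coordVec (x : M) (i j) {y : M} (hy : y ∈ chartDomain E x) :
    differential E (coordFun E x i) y (coordVec E x j y) = if i = j then 1 else 0 := by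
  refine (differential_linear_extChartAt x _ hy _).trans ?_
  have hb : y ∈ (trivializationAt E (TangentSpace 𝓘(ℂ, E)) x).baseSet := by
    rwa [TangentBundle.trivializationAt_baseSet]
  rw [coordVec, Bundle.Trivialization.localFrame_apply_of_mem_baseSet _ _ hb]
  have h := (trivializationAt E (TangentSpace 𝓘(ℂ, E)) x).linearMapAt_symmₗ (R := ℂ) hb
    (Module.finBasis ℂ E j)
  rw [Bundle.Trivialization.coe_symmₗ _ hb] at h
  simp [Bundle.Trivialization.basisAt, h, Finsupp.single_apply, eq_comm]

theorem isHolVector_coordVec (x : M) (j) : IsHolVector E (coordVec E x j) (chartDomain E x) := by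
  have := (trivializationAt E (TangentSpace 𝓘(ℂ, E)) x).contMDiffOn_localFrame_baseSet
    (I := 𝓘(ℂ, E)) ω (Module.finBasis ℂ E) j
  rwa [TangentBundle.trivializationAt_baseSet] at this

/-- Hadamard's lemma in the coordinates of the chart at `x`. -/
theorem IsHol.exists_eq_add_sum {x y : M} (hy : y ∈ chartDomain E x) {f : M → ℂ} {V : Opens M}
    (hf : IsHol E f V) (hyV : y ∈ V) :
    ∃ (W : Opens M) (g : Fin (Module.finrank ℂ E) → M → ℂ), y ∈ W ∧ W ≤ V ∧
      W ≤ chartDomain E x ∧ (∀ j, IsHol E (g j) W) ∧ ∀ w ∈ W,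
        f w = f y + ∑ j, (coordFun E x j w - coordFun E x j y) * g j w := by
  set φ := extChartAt 𝓘(ℂ, E) x
  have hyφ : y ∈ φ.source := by rwa [extChartAt_source]
  have hF : AnalyticAt ℂ (f ∘ φ.symm) (φ y) := by
    refine ContDiffAt.analyticAt (contMDiffAt_iff_contDiffAt.mp ?_)
    have h1 : ContMDiffAt 𝓘(ℂ, E) 𝓘(ℂ, ℂ) ω f (φ.symm (φ y)) := by
      rw [φ.left_inv hyφ]
      exact hf.contMDiffAt (V.isOpen.mem_nhds hyV)
    exact h1.comp _ ((contMDiffOn_extChartAt_symm x).contMDiffAt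
      ((isOpen_extChartAt_target x).mem_nhds (φ.map_source hyφ)))
  obtain ⟨G, hG, hfG⟩ := exists_analyticAt_slope hF
  have hcont : ContinuousAt φ y := continuousAt_extChartAt' hyφ
  -- Analyticity of G is required at all nearby points, not only at φ y, so that the coefficients
  -- are holomorphic on the whole of W.
  obtain ⟨W, hW, hWo, hyW⟩ := eventually_nhds_iff.mp
    ((hcont.eventually (hG.eventually_analyticAt.and hfG)).and
      ((V.isOpen.eventually_mem hyV).and ((chartDomain E x).isOpen.eventually_mem hy)))
  refine ⟨⟨W, hWo⟩, fun j w ↦ G (φ w) (Module.finBasis ℂ E j), hyW, fun w hw ↦ (hW w hw).2.1,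
    fun w hw ↦ (hW w hw).2.2, fun j w hw ↦ ?_, fun w hw ↦ ?_⟩
  · have h1 : ContDiffAt ℂ ω (fun z ↦ G z (Module.finBasis ℂ E j)) (φ w) :=
      (hW w hw).1.1.contDiffAt.clm_apply contDiffAt_const
    have h2 : ContMDiffAt 𝓘(ℂ, E) 𝓘(ℂ, E) ω φ w :=
      contMDiffAt_extChartAt' (hW w hw).2.2
    exact ((contMDiffAt_iff_contDiffAt.mpr h1).comp w h2).contMDiffWithinAt
  · have hwφ : w ∈ φ.source := by
      rw [extChartAt_source]
      exact (hW w hw).2.2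
    have h1 := (hW w hw).1.2
    simp only [Function.comp_apply, φ.left_inv hwφ, φ.left_inv hyφ] at h1
    rw [h1]
    -- Expanding the increment in the basis of E turns the linear form G (φ w) into the coefficients
    -- g_j.
    conv_lhs => rw [← (Module.finBasis ℂ E).sum_repr (φ w - φ y), map_sum]
    congr 1
    refine Finset.sum_congr rfl fun j _ ↦ ?_
    simp [coordFun, φ]

end Coordinates

/-! ### Vector-valued forms are determined by their values on functions -/

section Determination

variable {E : Type*} [NormedAddCommGroup E] [NormedSpace ℂ E] [FiniteDimensional ℂ E]
  {M : Type*} [TopologicalSpace M] [ChartedSpace E M]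

/-- In a basis e_i of W each tensor is ∑ e_i ⊗ η_i, and η_i is its pairing with the i-th coordinate
covector. -/
theorem eq_of_pairFibre_eq {W : Type*} [AddCommGroup W] [Module ℂ W] [FiniteDimensional ℂ W]
    {τ σ : W ⊗[ℂ] ExteriorAlgebra ℂ (Module.Dual ℂ W)}
    (h : ∀ ξ, pairFibre ξ τ = pairFibre ξ σ) : τ = σ := by
  have key : ∀ ρ : W ⊗[ℂ] ExteriorAlgebra ℂ (Module.Dual ℂ W),
      ρ = ∑ i, Module.finBasis ℂ W i ⊗ₜ[ℂ] pairFibre ((Module.finBasis ℂ W).coord i) ρ := by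
    intro ρ
    induction ρ using TensorProduct.induction_on with
    | zero => simp
    | tmul v η =>
      conv_lhs => rw [← (Module.finBasis ℂ W).sum_repr v, TensorProduct.sum_tmul]
      refine Finset.sum_congr rfl fun i _ ↦ ?_
      rw [pairFibre_tmul, TensorProduct.tmul_smul, TensorProduct.smul_tmul']
      rfl
    | add a b ha hb =>
      simp only [map_add, TensorProduct.tmul_add, Finset.sum_add_distrib]
      rw [← ha, ← hb]
  rw [key τ, key σ]
  simp only [h]

variable [IsManifold 𝓘(ℂ, E) ω M]

/-- Transport ξ to E by the derivative of the chart at x and compose the resulting linear form with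
the chart. -/
theorem exists_differential_eq (x : M) (ξ : Cot E x) :
    ∃ f, IsHol E f (chartDomain E x) ∧ differential E f x = ξ := by
  set e := trivializationAt E (TangentSpace 𝓘(ℂ, E)) x
  have hb : x ∈ e.baseSet := by
    rw [TangentBundle.trivializationAt_baseSet]
    exact mem_chart_source E x
  refine ⟨_, isHol_linear_extChartAt x (ξ ∘ₗ (e.symmL ℂ x).toLinearMap), ?_⟩
  ext v
  rw [differential_linear_extChartAt x _ (mem_chartDomain x)]
  exact congrArg ξ (e.symmL_continuousLinearMapAt hb v)

/-- The hypothesis ranges over smaller open sets W because a function with a prescribed differential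
at x is supplied only on a chart domain and need not extend to V. -/
theorem eq_of_pairFibre_differential_eq {x : M} {V : Opens M} (hx : x ∈ V)
    {τ σ : TangentSpace 𝓘(ℂ, E) x ⊗[ℂ] ExteriorAlgebra ℂ (Cot E x)}
    (h : ∀ W ≤ V, x ∈ W → ∀ f, IsHol E f W →
      pairFibre (differential E f x) τ = pairFibre (differential E f x) σ) : τ = σ := by
  have : FiniteDimensional ℂ (TangentSpace 𝓘(ℂ, E) x) := inferInstanceAs (FiniteDimensional ℂ E)
  refine eq_of_pairFibre_eq fun ξ ↦ ?_
  obtain ⟨f, hf, rfl⟩ := exists_differential_eq x ξ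
  exact h (chartDomain E x ⊓ V) inf_le_right ⟨mem_chartDomain x, hx⟩ f (hf.mono inf_le_left)

/-- Besides being the uniqueness assertion of the theorem, this is how identities of vector-valued
forms are checked below: linearity of α, its compatibility with restriction, and the splitting
identity. -/
theorem VecForms.ext_of_pairFibre {p : ℤ} {U : Opens M} {τ σ : VecForms E p U}
    (h : ∀ (V : Opens M) (hV : V ≤ U) (f : M → ℂ), IsHol E f V → ∀ x : V,
      pairFibre (differential E f x.1) (τ.1 ⟨x.1, hV x.2⟩) =
        pairFibre (differential E f x.1) (σ.1 ⟨x.1, hV x.2⟩)) : τ = σ :=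
  Subtype.ext <| funext fun x ↦ eq_of_pairFibre_differential_eq x.2
    fun W hW hxW f hf ↦ h W hW f hf ⟨x.1, hxW⟩

end Determination

/-! ### Derivations -/

section Derivation

variable {E : Type*} [NormedAddCommGroup E] [NormedSpace ℂ E]
  {M : Type*} [TopologicalSpace M] [ChartedSpace E M]

theorem SheafEnd.app_res {U : Opens M} (δ : SheafEnd E U) {V W : Opens M} (hV : V ≤ U)
    (hW : W ≤ V) (s : Forms E V) :
    SheafEnd.app E δ (hW.trans hV) (Forms.res E hW s) =
      Forms.res E hW (SheafEnd.app E δ hV s) :=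
  δ.2 ⟨W, hW.trans hV⟩ ⟨V, hV⟩ hW s

/-- Endomorphisms of a sheaf commute with restriction, so both values can be read off over W. This
compares the values of δ on one function considered over two different open sets. -/
theorem SheafEnd.app_apply_eq_of_res_eq {U : Opens M} (δ : SheafEnd E U) {V V' W : Opens M}
    (hV : V ≤ U) (hV' : V' ≤ U) (hW : W ≤ V) (hW' : W ≤ V') {s : Forms E V} {s' : Forms E V'}
    (h : Forms.res E hW s = Forms.res E hW' s') {x : M} (hx : x ∈ W) :
    (SheafEnd.app E δ hV s).1 ⟨x, hW hx⟩ = (SheafEnd.app E δ hV' s').1 ⟨x, hW' hx⟩ := by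
  have h1 := SheafEnd.app_res δ hV hW s
  rw [h, SheafEnd.app_res δ hV' hW' s'] at h1
  exact (congrFun (congrArg Subtype.val h1) ⟨x, hx⟩).symm

theorem SheafEnd.ext {U : Opens M} {δ δ' : SheafEnd E U}
    (h : ∀ (V : Opens M) (hV : V ≤ U) (s : Forms E V),
      SheafEnd.app E δ hV s = SheafEnd.app E δ' hV s) : δ = δ' :=
  Subtype.ext <| funext fun V ↦ LinearMap.ext fun s ↦ h V.1 V.2 s

theorem funForm_mem (f : M → ℂ) {V : Opens M} (hf : IsHol E f V) :
    funForm E f hf ∈ FormsDeg E 0 V := fun _ ↦ algebraMap_mem_piece _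

theorem algebraMap_mem_FormsDeg (V : Opens M) (c : ℂ) :
    algebraMap ℂ (Forms E V) c ∈ FormsDeg E 0 V := fun _ ↦ algebraMap_mem_piece _

/-- From δ(1) = δ(1 · 1) = δ(1) + δ(1). -/
theorem Der.app_algebraMap {p : ℤ} {U : Opens M} {δ : SheafEnd E U} (hδ : δ ∈ Der E p U)
    {V : Opens M} (hV : V ≤ U) (c : ℂ) : SheafEnd.app E δ hV (algebraMap ℂ _ c) = 0 := by
  have h1 := (hδ V hV 0 1 (by simpa using algebraMap_mem_FormsDeg V 1)).2 1
  simp only [mul_one, one_mul, mul_zero, zpow_zero, one_smul, left_eq_add] at h1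
  rw [Algebra.algebraMap_eq_smul_one, map_smul, h1, smul_zero]

/-- A derivation which vanishes on functions and their differentials is zero. -/
theorem Der.eq_zero [FiniteDimensional ℂ E] [IsManifold 𝓘(ℂ, E) ω M] {p : ℤ} {U : Opens M}
    {δ : SheafEnd E U} (hδ : δ ∈ Der E p U)
    (hfun : ∀ (V : Opens M) (hV : V ≤ U) (f : M → ℂ) (hf : IsHol E f V),
      SheafEnd.app E δ hV (funForm E f hf) = 0)
    (hdiff : ∀ (V : Opens M) (hV : V ≤ U) (f : M → ℂ) (hf : IsHol E f V),
      SheafEnd.app E δ hV (SheafEnd.app E (extDiff E U) hV (funForm E f hf)) = 0) : δ = 0 := by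
  have key : ∀ (V : Opens M) (hV : V ≤ U) (a : RawForm E V) (ha : a ∈ regular E V),
      SheafEnd.app E δ hV ⟨a, mem_Forms_of_regular ha⟩ = 0 := by
    intro V hV a ha
    -- The degree q is recorded because the Leibniz rule is available only for a homogeneous left
    -- factor.
    have hgen : ∀ a ∈ {a | ∃ f : M → ℂ, IsHol E f V ∧ (a = funField E f V ∨ a = diffField E f V)},
        ∃ s : Forms E V, s.1 = a ∧ SheafEnd.app E δ hV s = 0 ∧ ∃ q, s ∈ FormsDeg E q V := by
      rintro a ⟨f, hf, rfl | rfl⟩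
      · exact ⟨funForm E f hf, rfl, hfun V hV f hf, 0, funForm_mem f hf⟩
      · exact ⟨_, extD_funField hf, hdiff V hV f hf, _,
          (extDiff_mem_Der U V hV 0 _ (funForm_mem f hf)).1⟩
    suffices h : ∃ s : Forms E V, s.1 = a ∧ SheafEnd.app E δ hV s = 0 by
      obtain ⟨s, rfl, hs⟩ := h
      exact hs
    -- The generated algebra is the span of products of generators. Such a product is built up by
    -- left multiplication with one homogeneous generator at a time, as the Leibniz rule demands.
    rw [regular, ← Subalgebra.mem_toSubmodule, Algebra.adjoin_eq_span] at ha
    induction ha using Submodule.span_induction with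
    | mem a ha =>
      induction ha using Submonoid.closure_induction_left with
      | one => exact ⟨algebraMap ℂ _ 1, map_one _, Der.app_algebraMap hδ hV 1⟩
      | mul_left a ha b _ ihb =>
        obtain ⟨s, rfl, hs, q, hq⟩ := hgen a ha
        obtain ⟨t, rfl, ht⟩ := ihb
        refine ⟨s * t, rfl, ?_⟩
        rw [(hδ V hV q s hq).2 t, hs, ht, zero_mul, mul_zero, smul_zero, add_zero]
    | zero => exact ⟨0, rfl, map_zero _⟩
    | add a b _ _ iha ihb =>
      obtain ⟨s, rfl, hs⟩ := iha
      obtain ⟨t, rfl, ht⟩ := ihb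
      exact ⟨s + t, rfl, by rw [map_add, hs, ht, add_zero]⟩
    | smul c a _ iha =>
      obtain ⟨s, rfl, hs⟩ := iha
      exact ⟨c • s, rfl, by rw [map_smul, hs, smul_zero]⟩
  refine SheafEnd.ext fun V hV s ↦ Subtype.ext (funext fun x ↦ ?_)
  -- Every form is regular near x, and δ commutes with restriction to that neighbourhood.
  obtain ⟨W, hW, hxW, hs⟩ := s.2 x.1 x.2
  have h1 := SheafEnd.app_res δ hV hW s
  rw [show Forms.res E hW s = ⟨_, mem_Forms_of_regular hs⟩ from rfl, key W _ _ hs] at h1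
  exact (congrFun (congrArg Subtype.val h1) ⟨x.1, hxW⟩).symm

variable [FiniteDimensional ℂ E] [IsManifold 𝓘(ℂ, E) ω M]

/-- A derivation of functions is determined at a point by the values on the coordinates. -/
theorem Der.app_funForm_eq_sum {x y : M} (hy : y ∈ chartDomain E x) {f : M → ℂ} {V : Opens M}
    (hf : IsHol E f V) (hyV : y ∈ V) :
    ∃ c : Fin (Module.finrank ℂ E) → ℂ, ∀ (p : ℤ) (U : Opens M) (δ : SheafEnd E U)
      (_ : δ ∈ Der E p U) (hV : V ≤ U),
      (SheafEnd.app E δ hV (funForm E f hf)).1 ⟨y, hyV⟩ =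
        ∑ j, c j • (SheafEnd.app E δ (inf_le_right : chartDomain E x ⊓ U ≤ U)
          (funForm E (coordFun E x j) ((isHol_coordFun x j).mono inf_le_left))).1
            ⟨y, hy, hV hyV⟩ := by
  obtain ⟨W, g, hyW, hWV, hWx, hg, hfg⟩ := hf.exists_eq_add_sum hy hyV
  -- The coefficients are chosen before p, U and δ: they depend on f and y alone, so they can later
  -- be computed by means of one particular derivation.
  refine ⟨fun j ↦ g j y, fun p U δ hδ hV ↦ ?_⟩
  have hz : ∀ j, IsHol E (coordFun E x j) W := fun j ↦ (isHol_coordFun x j).mono hWx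
  have hWU := hWV.trans hV
  have h1 : Forms.res E hWV (funForm E f hf) = algebraMap ℂ _ (f y) +
      ∑ j, (funForm E _ (hz j) - algebraMap ℂ _ (coordFun E x j y)) * funForm E _ (hg j) := by
    refine Subtype.ext (funext fun w ↦ ?_)
    have h2 : ∀ s : Fin (Module.finrank ℂ E) → Forms E W,
        (∑ j, s j).1 w = ∑ j, (s j).1 w := fun s ↦ by
      rw [← Finset.sum_apply]
      exact congrFun (map_sum (Forms.val E W) s Finset.univ) w
    change algebraMap ℂ _ (f w.1) = algebraMap ℂ _ (f y) + (∑ j, _ : Forms E W).1 w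
    rw [h2, hfg w.1 w.2, map_add, map_sum]
    congr 1
    refine Finset.sum_congr rfl fun j _ ↦ ?_
    rw [map_mul, map_sub]
    rfl
  have h3 := SheafEnd.app_res δ hV hWV (funForm E f hf)
  rw [h1, map_add, Der.app_algebraMap hδ, zero_add, map_sum] at h3
  have h4 := congrFun (congrArg (Forms.val E W) h3) ⟨y, hyW⟩
  refine h4.symm.trans ?_
  rw [map_sum, Finset.sum_apply]
  refine Finset.sum_congr rfl fun j _ ↦ ?_
  rw [(hδ W hWU 0 _ (sub_mem (funForm_mem _ (hz j)) (algebraMap_mem_FormsDeg W _))).2, map_sub,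
    Der.app_algebraMap hδ, sub_zero]
  -- Hadamard's expansion lives on W, whereas the statement uses the coordinates on the whole of
  -- `chartDomain E x ⊓ U`.
  have h5 := SheafEnd.app_apply_eq_of_res_eq δ hWU inf_le_right le_rfl (le_inf hWx hWU)
    (s := funForm E _ (hz j))
    (s' := funForm E (coordFun E x j) ((isHol_coordFun x j).mono inf_le_left)) rfl hyW
  rw [← h5]
  -- At y the factor z_j - z_j(y) vanishes and removes the term containing δ g_j.
  change (SheafEnd.app E δ hWU (funForm E _ (hz j))).1 ⟨y, hyW⟩ * algebraMap ℂ _ (g j y) +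
    ((-1 : ℂ) ^ (p * 0)) • ((algebraMap ℂ _ (coordFun E x j y) - algebraMap ℂ _ (coordFun E x j y))
      * _) = _
  rw [sub_self, zero_mul, smul_zero, add_zero, ← Algebra.commutes, ← Algebra.smul_def]

/-- The chain rule for derivations: `δ f = ∑ ∂_j f δ z_j`. -/
theorem Der.app_funForm_eq_sum_differential {x y : M} (hy : y ∈ chartDomain E x) {f : M → ℂ}
    {V : Opens M} (hf : IsHol E f V) (hyV : y ∈ V) {p : ℤ} {U : Opens M} {δ : SheafEnd E U}
    (hδ : δ ∈ Der E p U) (hV : V ≤ U) :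
    (SheafEnd.app E δ hV (funForm E f hf)).1 ⟨y, hyV⟩ =
      ∑ j, differential E f y (coordVec E x j y) •
        (SheafEnd.app E δ (inf_le_right : chartDomain E x ⊓ U ≤ U)
          (funForm E (coordFun E x j) ((isHol_coordFun x j).mono inf_le_left))).1
            ⟨y, hy, hV hyV⟩ := by
  obtain ⟨c, hc⟩ := Der.app_funForm_eq_sum hy hf hyV
  -- Taking δ = d gives df = ∑ c_j dz_j at y. Evaluation on the dual frame then identifies c_j with
  -- ∂_j f(y).
  have h1 := hc 1 U _ (extDiff_mem_Der U) hV
  have hd : ∀ {g : M → ℂ} {W : Opens M} (hg : IsHol E g W) (hW : W ≤ U) (hyW : y ∈ W),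
      (SheafEnd.app E (extDiff E U) hW (funForm E g hg)).1 ⟨y, hyW⟩ =
        ExteriorAlgebra.ι ℂ (differential E g y) := fun hg hW hyW ↦
    congrFun (extD_funField hg) ⟨y, hyW⟩
  have h2 : differential E f y = ∑ j, c j • differential E (coordFun E x j) y := by
    refine (ExteriorAlgebra.ι_leftInverse (R := ℂ)).injective ?_
    simp only [map_sum, map_smul]
    exact (hd hf hV hyV).symm.trans (h1.trans (Finset.sum_congr rfl fun j _ ↦
      congrArg (c j • ·) (hd _ inf_le_right _)))
  rw [hc p U δ hδ hV]
  refine Finset.sum_congr rfl fun j _ ↦ ?_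
  rw [h2]
  simp [LinearMap.sum_apply, differential_coordFun_coordVec x _ _ hy]

end Derivation

/-! ### The value of a derivation on functions as a vector-valued form -/

section Insertion

theorem insertFibre_algebraMap {W : Type*} [AddCommGroup W] [Module ℂ W]
    (τ : W ⊗[ℂ] ExteriorAlgebra ℂ (Module.Dual ℂ W)) (c : ℂ) :
    insertFibre τ (algebraMap ℂ _ c) = 0 := by
  induction τ using TensorProduct.induction_on with
  | zero => simp
  | tmul v η => rw [insertFibre_tmul, contract_algebraMap, mul_zero]
  | add a b ha hb => rw [map_add, LinearMap.add_apply, ha, hb, add_zero]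

/-- For ξ = df this is the identity i(ω) df = ω(f), on which all later computations rest. -/
theorem insertFibre_iota {W : Type*} [AddCommGroup W] [Module ℂ W]
    (τ : W ⊗[ℂ] ExteriorAlgebra ℂ (Module.Dual ℂ W)) (ξ : Module.Dual ℂ W) :
    insertFibre τ (ExteriorAlgebra.ι ℂ ξ) = pairFibre ξ τ := by
  induction τ using TensorProduct.induction_on with
  | zero => simp
  | tmul v η =>
    rw [insertFibre_tmul, contract_iota, pairFibre_tmul, ← Algebra.commutes, ← Algebra.smul_def]
  | add a b ha hb => rw [map_add, LinearMap.add_apply, ha, hb, map_add]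

variable {E : Type*} [NormedAddCommGroup E] [NormedSpace ℂ E] [FiniteDimensional ℂ E]
  {M : Type*} [TopologicalSpace M] [ChartedSpace E M] [IsManifold 𝓘(ℂ, E) ω M]
  {p : ℤ} {U V : Opens M}

/-! ### The operators d, i(ω) and [i(ω), d] on functions -/

theorem extDiff_funForm_apply (hV : V ≤ U) {f : M → ℂ} (hf : IsHol E f V) (x : V) :
    (SheafEnd.app E (extDiff E U) hV (funForm E f hf)).1 x =
      ExteriorAlgebra.ι ℂ (differential E f x.1) :=
  congrFun (extD_funField hf) x

theorem extDiff_extDiff_funForm (hV : V ≤ U) {f : M → ℂ} (hf : IsHol E f V) :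
    SheafEnd.app E (extDiff E U) hV (SheafEnd.app E (extDiff E U) hV (funForm E f hf)) = 0 :=
  Subtype.ext ((congrArg (extD E) (extD_funField hf)).trans (extD_diffField hf))

variable (E) in
-- The bracket [d, d] = 2d² is a derivation, and it vanishes on f and df because d(df) = 0.
theorem extDiff_mul_extDiff (U : Opens M) : extDiff E U * extDiff E U = 0 := by
  have h : superBracket 1 1 (extDiff E U) (extDiff E U) = 0 := by
    refine Der.eq_zero (superBracket_mem (extDiff_mem_Der U) (extDiff_mem_Der U)) ?_ ?_ <;>
    · intro V hV f hf
      rw [superBracket_app]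
      simp only [extDiff_extDiff_funForm, map_zero, smul_zero, sub_zero]
  have h2 : superBracket 1 1 (extDiff E U) (extDiff E U) =
      (2 : ℂ) • (extDiff E U * extDiff E U) := by
    rw [superBracket, mul_one, zpow_one, neg_one_smul, sub_neg_eq_add, two_smul]
  rw [h2] at h
  exact (smul_eq_zero.mp h).resolve_left two_ne_zero

omit [FiniteDimensional ℂ E] in
theorem insertion_funForm (τ : VecForms E p U) (hV : V ≤ U) {f : M → ℂ} (hf : IsHol E f V) :
    SheafEnd.app E (insertion E p U τ) hV (funForm E f hf) = 0 :=
  Subtype.ext <| funext fun _ ↦ insertFibre_algebraMap _ _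

theorem insertion_extDiff_funForm_apply (τ : VecForms E p U) (hV : V ≤ U) {f : M → ℂ}
    (hf : IsHol E f V) (x : V) :
    (SheafEnd.app E (insertion E p U τ) hV
      (SheafEnd.app E (extDiff E U) hV (funForm E f hf))).1 x =
      pairFibre (differential E f x.1) (τ.1 ⟨x.1, hV x.2⟩) :=
  (congrArg (insertFibre _) (extDiff_funForm_apply hV hf x)).trans (insertFibre_iota _ _)

/-- Since i(ω) kills f, only the term i(ω) df of the bracket survives. -/
theorem splitting_funForm_apply (τ : VecForms E p U) (hV : V ≤ U) {f : M → ℂ}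
    (hf : IsHol E f V) (x : V) :
    (SheafEnd.app E (splitting E p U τ).1 hV (funForm E f hf)).1 x =
      pairFibre (differential E f x.1) (τ.1 ⟨x.1, hV x.2⟩) := by
  rw [← insertion_extDiff_funForm_apply τ hV hf x]
  change (SheafEnd.app E (superBracket (p - 1) 1 _ _) hV _).1 x = _
  rw [superBracket_app, insertion_funForm, map_zero, smul_zero, sub_zero]

/-! ### The map α from derivations to vector-valued forms -/

/-- The vector-valued form with the same values on functions as the derivation `δ`. -/
noncomputable def symbolField (δ : SheafEnd E U) : RawVecForm E U := fun x ↦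
  ∑ j, coordVec E x.1 j x.1 ⊗ₜ[ℂ]
    (SheafEnd.app E δ (inf_le_right : chartDomain E x.1 ⊓ U ≤ U)
      (funForm E (coordFun E x.1 j) ((isHol_coordFun x.1 j).mono inf_le_left))).1
        ⟨x.1, mem_chartDomain x.1, x.2⟩

/-- The chain rule at the point x in its own chart. -/
theorem pairFibre_symbolField {δ : SheafEnd E U} (hδ : δ ∈ Der E p U) (hV : V ≤ U) {f : M → ℂ}
    (hf : IsHol E f V) (x : V) :
    pairFibre (differential E f x.1) (symbolField δ ⟨x.1, hV x.2⟩) =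
      (SheafEnd.app E δ hV (funForm E f hf)).1 x := by
  rw [Der.app_funForm_eq_sum_differential (mem_chartDomain x.1) hf x.2 hδ hV, symbolField, map_sum]
  simp only [pairFibre_tmul]

theorem symbolField_mem {δ : SheafEnd E U} (hδ : δ ∈ Der E p U) :
    symbolField δ ∈ VecForms E p U := by
  intro x hx
  refine ⟨chartDomain E x ⊓ U, inf_le_right, ⟨mem_chartDomain x, hx⟩, ?_⟩
  have hz : ∀ j, IsHol E (coordFun E x j) (chartDomain E x ⊓ U) := fun j ↦
    (isHol_coordFun x j).mono inf_le_left
  -- `symbolField` uses a different chart at each point, so holomorphy is not visible from its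
  -- definition. Near x it equals the sum formed in the single chart at x: by the chain rule at y in
  -- that chart, both have the same values on functions.
  have h1 : RawVecForm.res E (inf_le_right : chartDomain E x ⊓ U ≤ U) (symbolField δ) =
      ∑ j, fun y ↦ coordVec E x j y.1 ⊗ₜ[ℂ]
        (SheafEnd.app E δ inf_le_right (funForm E _ (hz j))).1 y := by
    funext y
    refine eq_of_pairFibre_differential_eq y.2 fun W hW hyW f hf ↦ ?_
    refine (pairFibre_symbolField hδ (hW.trans inf_le_right) hf ⟨y.1, hyW⟩).trans ?_
    rw [Der.app_funForm_eq_sum_differential y.2.1 hf hyW hδ (hW.trans inf_le_right),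
      Finset.sum_apply, map_sum]
    simp only [pairFibre_tmul]
  rw [h1]
  refine sum_mem fun j _ ↦ Submodule.subset_span ⟨coordVec E x j,
    (isHolVector_coordVec x j).mono inf_le_left, _, ?_, rfl⟩
  have := (hδ _ inf_le_right 0 _ (funForm_mem _ (hz j))).1
  rwa [zero_add] at this

variable (E p U) in
/-- The map `Der_p Ω → T ⊗ Ω^p` given by the restriction of derivations to functions. -/
noncomputable def symbol : Der E p U →ₗ[ℂ] VecForms E p U where
  toFun δ := ⟨symbolField δ.1, symbolField_mem δ.2⟩
  map_add' δ δ' := VecForms.ext_of_pairFibre fun _ hV _ hf x ↦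
    (pairFibre_symbolField (δ + δ').2 hV hf x).trans <|
      (congrArg₂ (· + ·) (pairFibre_symbolField δ.2 hV hf x).symm
        (pairFibre_symbolField δ'.2 hV hf x).symm).trans (map_add (pairFibre _) _ _).symm
  map_smul' c δ := VecForms.ext_of_pairFibre fun _ hV _ hf x ↦
    (pairFibre_symbolField (c • δ).2 hV hf x).trans <|
      (congrArg (c • ·) (pairFibre_symbolField δ.2 hV hf x).symm).trans
        (map_smul (pairFibre _) c _).symm

theorem pairFibre_symbol (δ : Der E p U) (hV : V ≤ U) {f : M → ℂ} (hf : IsHol E f V) (x : V) :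
    pairFibre (differential E f x.1) ((symbol E p U δ).1 ⟨x.1, hV x.2⟩) =
      (SheafEnd.app E δ.1 hV (funForm E f hf)).1 x :=
  pairFibre_symbolField δ.2 hV hf x

theorem symbol_res (h : V ≤ U) (δ : Der E p U) :
    symbol E p V (Der.res E p h δ) = VecForms.res E p h (symbol E p U δ) :=
  VecForms.ext_of_pairFibre fun _ hW _ hf x ↦
    (pairFibre_symbol (Der.res E p h δ) hW hf x).trans
      (pairFibre_symbol δ (hW.trans h) hf x).symm

/-- This also yields surjectivity of α over each U, with no passage to smaller open sets. -/
theorem symbol_splitting (τ : VecForms E p U) : symbol E p U (splitting E p U τ) = τ :=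
  VecForms.ext_of_pairFibre fun _ hV _ hf x ↦
    (pairFibre_symbol _ hV hf x).trans (splitting_funForm_apply τ hV hf x)

theorem symbol_eq_zero_iff {δ : Der E p U} : symbol E p U δ = 0 ↔
    ∀ (V : Opens M) (hV : V ≤ U) (f : M → ℂ) (hf : IsHol E f V),
      SheafEnd.app E δ.1 hV (funForm E f hf) = 0 := by
  refine ⟨fun h V hV f hf ↦ Subtype.ext (funext fun x ↦ ?_), fun h ↦
    VecForms.ext_of_pairFibre fun V hV f hf x ↦ ?_⟩
  · refine (pairFibre_symbol δ hV hf x).symm.trans ?_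
    rw [h]
    exact map_zero _
  · rw [pairFibre_symbol δ hV hf x, h V hV f hf]
    exact (map_zero (pairFibre _)).symm

/-! ### Exactness of the sequence -/

theorem insertDer_injective : Function.Injective (insertDer E p U) := by
  intro τ σ h
  refine VecForms.ext_of_pairFibre fun V hV f hf x ↦ ?_
  rw [← insertion_extDiff_funForm_apply τ hV hf x, ← insertion_extDiff_funForm_apply σ hV hf x]
  rw [show insertion E (p + 1) U τ = insertion E (p + 1) U σ from congrArg Subtype.val h]

/-- If δ kills functions, then [δ, d] f = δ df. Hence the preimage of δ has to be the vector-valued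
form η = α([δ, d]), one degree higher, for which i(η) df = δ df. -/
theorem exact_insertDer_symbol : Function.Exact (insertDer E p U) (symbol E p U) := by
  intro δ
  refine ⟨fun h ↦ ?_, ?_⟩
  · have hfun := symbol_eq_zero_iff.mp h
    set ε : Der E (p + 1) U := ⟨superBracket p 1 δ.1 (extDiff E U),
      superBracket_mem δ.2 (extDiff_mem_Der U)⟩
    refine ⟨symbol E (p + 1) U ε, sub_eq_zero.mp (Subtype.ext ?_)⟩
    refine Der.eq_zero (insertDer E p U (symbol E (p + 1) U ε) - δ).2 (fun V hV f hf ↦ ?_)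
      fun V hV f hf ↦ ?_
    · change SheafEnd.app E (insertion E (p + 1) U _) hV _ - SheafEnd.app E δ.1 hV _ = 0
      rw [insertion_funForm, hfun, sub_zero]
    · change SheafEnd.app E (insertion E (p + 1) U _) hV _ - SheafEnd.app E δ.1 hV _ = 0
      refine sub_eq_zero.mpr (Subtype.ext (funext fun x ↦ ?_))
      rw [insertion_extDiff_funForm_apply, pairFibre_symbol ε hV hf x]
      change (SheafEnd.app E (superBracket p 1 δ.1 (extDiff E U)) hV _).1 x = _
      rw [superBracket_app, hfun, map_zero, smul_zero, sub_zero]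
  · rintro ⟨τ, rfl⟩
    exact symbol_eq_zero_iff.mpr fun V hV f hf ↦ insertion_funForm τ hV hf

/-! ### The centralizer of d and the direct sum decomposition -/

theorem splitting_mem_diffCentralizer (τ : VecForms E p U) :
    splitting E p U τ ∈ diffCentralizer E p U := by
  change superBracket p 1 (superBracket (p - 1) 1 (insertion E p U τ) (extDiff E U))
    (extDiff E U) = 0
  -- After d² = 0 only two multiples of d i(ω) d remain in the double bracket. This relation between
  -- the inner and outer signs makes them cancel.
  have hsign : (-1 : ℂ) ^ (p - 1) = -(-1) ^ p := by
    rw [zpow_sub_one₀ (by norm_num)]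
    norm_num
  simp only [superBracket, mul_one, hsign, sub_mul, mul_sub, smul_mul_assoc, mul_smul_comm,
    mul_assoc, extDiff_mul_extDiff, mul_zero]
  rw [← mul_assoc (extDiff E U) (extDiff E U), extDiff_mul_extDiff]
  simp

/-- Commutation with d gives δ df = ± d(δf) = 0, so δ kills differentials as well as functions. -/
theorem eq_zero_of_mem_diffCentralizer {δ : Der E p U} (hδ : δ ∈ diffCentralizer E p U)
    (h : symbol E p U δ = 0) : δ = 0 := by
  have hfun := symbol_eq_zero_iff.mp h
  refine Subtype.ext (Der.eq_zero δ.2 hfun fun V hV f hf ↦ ?_)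
  have h1 := superBracket_app p 1 δ.1 (extDiff E U) hV (funForm E f hf)
  rw [hfun, map_zero, smul_zero, sub_zero] at h1
  rw [← h1, show superBracket p 1 δ.1 (extDiff E U) = 0 from hδ]
  rfl

theorem range_splitting : LinearMap.range (splitting E p U) = diffCentralizer E p U := by
  refine le_antisymm ?_ fun δ hδ ↦ ⟨symbol E p U δ, ?_⟩
  · rintro _ ⟨τ, rfl⟩
    exact splitting_mem_diffCentralizer τ
  -- The difference δ - [i(α(δ)), d] commutes with d and is annihilated by α.
  · refine (sub_eq_zero.mp (eq_zero_of_mem_diffCentralizer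
      (sub_mem hδ (splitting_mem_diffCentralizer (symbol E p U δ))) ?_)).symm
    rw [map_sub, symbol_splitting, sub_self]

variable (E p U) in
/-- The map `(ω, η) ↦ [i(ω), d] + i(η)` is an isomorphism. -/
theorem bijective_splitting_coprod_insertDer :
    Function.Bijective ((splitting E p U).coprod (insertDer E p U)) := by
  have hzero : ∀ σ, symbol E p U (insertDer E p U σ) = 0 := exact_insertDer_symbol.apply_apply_eq_zero
  constructor
  · rw [injective_iff_map_eq_zero]
    rintro ⟨τ, σ⟩ h
    rw [LinearMap.coprod_apply] at h
    -- Applying α removes the summand i(σ) and leaves τ = 0.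
    have hτ := congrArg (symbol E p U) h
    rw [map_add, symbol_splitting, hzero, add_zero, map_zero] at hτ
    subst hτ
    rw [map_zero, zero_add] at h
    exact Prod.ext rfl (insertDer_injective (h.trans (map_zero _).symm))
  · intro δ
    obtain ⟨σ, hσ⟩ := (exact_insertDer_symbol (δ - splitting E p U (symbol E p U δ))).mp
      (by rw [map_sub, symbol_splitting, sub_self])
    exact ⟨(symbol E p U δ, σ), by rw [LinearMap.coprod_apply, hσ, add_sub_cancel]⟩

end Insertion

end HolForm

theorem mainTheorem5 {E : Type*} [NormedAddCommGroup E] [NormedSpace ℂ E] [FiniteDimensional ℂ E]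
    {M : Type*} [TopologicalSpace M] [ChartedSpace E M] [IsManifold 𝓘(ℂ, E) ω M]
    (p : ℤ) (hp : -1 ≤ p) :
    -- a vector-valued form is determined by its values on the differentials of functions
    (∀ (U : Opens M) (τ σ : HolForm.VecForms E p U),
      (∀ (V : Opens M) (hV : V ≤ U) (f : M → ℂ), HolForm.IsHol E f V → ∀ x : V,
        HolForm.pairFibre (HolForm.differential E f x.1) (τ.1 ⟨x.1, hV x.2⟩) =
          HolForm.pairFibre (HolForm.differential E f x.1) (σ.1 ⟨x.1, hV x.2⟩)) → τ = σ) ∧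
    ∃ α : ∀ U : Opens M, HolForm.Der E p U →ₗ[ℂ] HolForm.VecForms E p U,
      -- `α` is the restriction of derivations to functions
      (∀ (U : Opens M) (δ : HolForm.Der E p U) (V : Opens M) (hV : V ≤ U) (f : M → ℂ)
        (hf : HolForm.IsHol E f V) (x : V),
        (HolForm.SheafEnd.app E δ.1 hV (HolForm.funForm E f hf)).1 x =
          HolForm.pairFibre (HolForm.differential E f x.1) ((α U δ).1 ⟨x.1, hV x.2⟩)) ∧
      -- `α`, `ω ↦ i(ω)` and `ω ↦ [i(ω), d]` are morphisms of sheaves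
      (∀ (U V : Opens M) (h : V ≤ U) (δ : HolForm.Der E p U),
        α V (HolForm.Der.res E p h δ) = HolForm.VecForms.res E p h (α U δ)) ∧
      (∀ (U V : Opens M) (h : V ≤ U) (τ : HolForm.VecForms E (p + 1) U),
        HolForm.insertDer E p V (HolForm.VecForms.res E (p + 1) h τ) =
          HolForm.Der.res E p h (HolForm.insertDer E p U τ)) ∧
      (∀ (U V : Opens M) (h : V ≤ U) (τ : HolForm.VecForms E p U),
        HolForm.splitting E p V (HolForm.VecForms.res E p h τ) =
          HolForm.Der.res E p h (HolForm.splitting E p U τ)) ∧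
      ∀ U : Opens M,
        -- the sequence is exact
        Function.Injective (HolForm.insertDer E p U) ∧
        Function.Exact (HolForm.insertDer E p U) (α U) ∧
        Function.Surjective (α U) ∧
        -- `ω ↦ [i(ω), d]` splits it
        α U ∘ₗ HolForm.splitting E p U = LinearMap.id ∧
        -- the resulting direct sum decomposition
        (∃ e : (HolForm.VecForms E p U × HolForm.VecForms E (p + 1) U) ≃ₗ[ℂ] HolForm.Der E p U,
          ∀ τ σ, e (τ, σ) = HolForm.splitting E p U τ + HolForm.insertDer E p U σ) ∧
        -- the image of the splitting is the centralizer of `d`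
        LinearMap.range (HolForm.splitting E p U) = HolForm.diffCentralizer E p U := by
  -- Compatibility of i(ω) and [i(ω), d] with restriction holds by definition: restricting an
  -- endomorphism only forgets its components over larger open sets, and the component over V uses
  -- the values of ω at points of V alone.
  refine ⟨fun U τ σ h ↦ HolForm.VecForms.ext_of_pairFibre h, HolForm.symbol E p,
    fun U δ V hV f hf x ↦ (HolForm.pairFibre_symbol δ hV hf x).symm,
    fun U V h δ ↦ HolForm.symbol_res h δ, fun U V h τ ↦ rfl, fun U V h τ ↦ rfl, fun U ↦
    ⟨HolForm.insertDer_injective, HolForm.exact_insertDer_symbol,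
      fun τ ↦ ⟨_, HolForm.symbol_splitting τ⟩, LinearMap.ext HolForm.symbol_splitting,
      ⟨LinearEquiv.ofBijective _ (HolForm.bijective_splitting_coprod_insertDer E p U),
        fun τ σ ↦ rfl⟩,
      HolForm.range_splitting⟩⟩
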